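/- Let $K$ be a field and $E=(E^0,E^1,r,s)$ an arbitrary directed graph. Let $L=L_K(E)$ be its Leavitt path algebra: the free associative (not necessarily unital) $K$-algebra on $E^0\cup E^1\cup (E^1)^*$ modulo the relations $vv'=\delta_{v,v'}v$; $s(e)e=e\,r(e)=e$; $r(e)e^*=e^*s(e)=e^*$; $e^*f=\delta_{e,f}r(e)$; and $v=\sum_{s(e)=v}ee^*$ for every regular vertex $v$ (one emitting at least one and only finitely many edges). Let ${}^\star$ be the standard involution ($K$-linear, $v^\star=v$, $e^\star=e^*$, $(e^*)^\star=e$), $\mathbf K_L=\{x\in L: x^\star=-x\}$, and $[L,L]=\mathrm{span}_K\{ab-ba: a,b\in L\}$. Vertices are regarded as paths of length $0$ and as closed paths; for a path $p=e_1\cdots e_n$ put $p^*=e_n^*\cdots e_1^*$ (and $v^*=v$). For closed paths write $p\sim q$ if $p=xy$, $q=yx$ for some paths $x,y$. For $v\in E^0$ let $\epsilon_v$ be the standard basis vector of $\mathbb Z^{(E^0)}$ (or of $K^{(E^0)}$), and let $B_v=(a_{vu})_{u\in E^0}-\epsilon_v$ if $v$ is regular, where $a_{vu}$ is the number of edges from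 $v$ to $u$, and $B_v=0$ otherwise; $\mathrm{span}_K\{B_v\}$ is the span of the images of these vectors in $K^{(E^0)}$. Call a *skew form* an expression $$D=\sum_{i=1}^{l}b_i(t_iq_i^*-q_it_i^*)+\sum_{i=1}^m\sum_{j=1}^{m_i}c_{ij}\bigl(x_{ij}y_{ij}^*x_{ij}^*-x_{ij}y_{ij}x_{ij}^*\bigr)$$ with $l,m\ge 0$, $m_i\ge 1$, $b_i,c_{ij}\in K$, paths $t_i,q_i,x_{ij}$ and closed paths $y_{ij}$ of positive length, with $r(t_i)=r(q_i)$ and $r(x_{ij})=s(y_{ij})$, such that $q_i\neq t_iu$ and $t_i\neq q_iu$ for every $i$ and every closed path $u$, and such that $y_{ij}\sim y_{i'j'}$ if and only if $i=i'$. Call $D$ *balanced* if $\sum_{j=1}^{m_i}c_{ij}=0$ for every $i$. Let $x\in L$. (i) Suppose $\mathrm{char}(K)\ne 2$. Then $x\in\mathbf K_L$ if and only if $x$ is equal to some skew form $D$; and $x\in\mathbf K_L\cap[L,L]$ if and only if $x$ is equal to some balanced skew form $D$. (ii) Suppose $\mathrm{char}(K)=2$. Then $x\in\mathbf K_L$ if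 and only if $$x=\sum_{i=1}^k a_ip_ip_i^*+D$$ for some $k\ge 0$, $a_i\in K$, paths $p_i$ and some skew form $D$; and $x\in\mathbf K_L\cap[L,L]$ if and only if there is such an expression in which $D$ is balanced and $\sum_{i=1}^k a_i\epsilon_{r(p_i)}\in\mathrm{span}_K\{B_v: v\in E^0\}$. -/

import Mathlib

/-- A directed graph `E = (E⁰, E¹, r, s)` with vertex set `V` and edge set `A`; loops, multiple edges
and infinite vertex or edge sets are allowed. -/
structure DirectedGraph (V : Type*) (A : Type*) where
  source : A → V
  range : A → V

namespace DirectedGraph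

variable {V A : Type*} (G : DirectedGraph V A)

/-- A vertex is regular if it emits at least one and only finitely many edges. -/
def IsRegular (v : V) : Prop :=
  {e : A | G.source e = v}.Finite ∧ {e : A | G.source e = v}.Nonempty

/-- `G.IsWalk u es w`: the list of edges `es` can be followed from `u` to `w`. -/
def IsWalk : V → List A → V → Prop
  | u, [], w => u = w
  | u, e :: es, w => G.source e = u ∧ IsWalk (G.range e) es w

/-- Finite paths of the graph; a path with an empty list of edges is a vertex. -/
@[ext]
structure Path where
  src : V
  tgt : V
  edges : List A
  isWalk : G.IsWalk src edges tgt

variable {G}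

/-- `p = ab` as paths (in particular `a` ends where `b` starts). -/
def Path.IsConcat (p a b : G.Path) : Prop :=
  p.src = a.src ∧ a.tgt = b.src ∧ p.tgt = b.tgt ∧ p.edges = a.edges ++ b.edges

/-- Closed paths, the vertices included. -/
def Path.IsClosed (p : G.Path) : Prop :=
  p.src = p.tgt

/-- Closed paths which are not vertices. -/
def Path.IsNontrivialClosed (p : G.Path) : Prop :=
  p.IsClosed ∧ p.edges ≠ []

/-- The relation `p ∼ q` on closed paths: `p = xy` and `q = yx` for some paths `x`, `y`. -/
def Path.Rotates (p q : G.Path) : Prop :=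
  ∃ x y : G.Path, p.IsConcat x y ∧ q.IsConcat y x

variable (G)

open Classical in
/-- The vector `B_v ∈ ℤ^(E⁰)`: if `v` is regular, its `u`-th coordinate is the number of edges from
`v` to `u`, minus `1` if `u = v`; otherwise `B_v = 0`. -/
noncomputable def B (v : V) : V →₀ ℤ :=
  if h : G.IsRegular v then
    (∑ e ∈ h.1.toFinset, Finsupp.single (G.range e) 1) - Finsupp.single v 1
  else 0

theorem B_apply {v : V} (h : G.IsRegular v) (u : V) [Decidable (u = v)] :
    G.B v u = ({e : A | G.source e = v ∧ G.range e = u}.ncard : ℤ) - if u = v then 1 else 0 := by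
  classical
  have hs : {e : A | G.source e = v ∧ G.range e = u} =
      ((h.1.toFinset.filter fun e => G.range e = u : Finset A) : Set A) := by
    ext e
    simp
  rw [hs, Set.ncard_coe_finset]
  simp [B, h, Finsupp.single_apply, eq_comm]

/-- The `K`-span of (the images in `K^(E⁰)` of) the vectors `B_v`. -/
noncomputable def spanB (K : Type*) [Field K] : Submodule K (V →₀ K) :=
  Submodule.span K
    (Set.range fun v : V => (G.B v).mapRange (Int.cast : ℤ → K) Int.cast_zero)

end DirectedGraph

/-! ### The Leavitt path algebra by generators and relations -/

/-- The generators: vertices, edges, and ghost edges `e*`. -/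
inductive LeavittGen (V : Type*) (A : Type*)
  | vtx : V → LeavittGen V A
  | edge : A → LeavittGen V A
  | ghost : A → LeavittGen V A

namespace LeavittGen

variable {V A : Type*}

/-- The involution on the generators. -/
def swap : LeavittGen V A → LeavittGen V A
  | vtx v => vtx v
  | edge e => ghost e
  | ghost e => edge e

theorem swap_swap (g : LeavittGen V A) : g.swap.swap = g := by cases g <;> rfl

end LeavittGen

/-- The free associative (not necessarily unital) `K`-algebra on the generators. -/
abbrev LeavittFree (K V A : Type*) [Field K] : Type _ :=
  MonoidAlgebra K (FreeSemigroup (LeavittGen V A))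

namespace LeavittFree

variable (K : Type*) {V A : Type*} [Field K]

/-- A generator as an element of the free algebra. -/
noncomputable def of (g : LeavittGen V A) : LeavittFree K V A :=
  MonoidAlgebra.single (FreeSemigroup.of g) 1

variable {K}

theorem hom_ext {B : Type*} [NonUnitalNonAssocSemiring B] [Module K B] [IsScalarTower K B B]
    [SMulCommClass K B B] {f g : LeavittFree K V A →ₙₐ[K] B}
    (h : ∀ x, f (of K x) = g (of K x)) : f = g := by
  apply (MonoidAlgebra.liftMagma K).symm.injective
  apply FreeSemigroup.hom_ext
  funext x
  exact h x

/-- The non-unital algebra homomorphism with given values on the generators. -/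
noncomputable def lift {B : Type*} [NonUnitalSemiring B] [Module K B] [IsScalarTower K B B]
    [SMulCommClass K B B] (f : LeavittGen V A → B) : LeavittFree K V A →ₙₐ[K] B :=
  MonoidAlgebra.liftMagma K (FreeSemigroup.lift f)

theorem lift_of {B : Type*} [NonUnitalSemiring B] [Module K B] [IsScalarTower K B B]
    [SMulCommClass K B B] (f : LeavittGen V A → B) (g : LeavittGen V A) :
    lift f (of K g) = f g := by
  simp [lift, of, MonoidAlgebra.liftMagma_apply_apply]

/-- The anti-homomorphism of the free algebra which fixes vertices and swaps `e` with `e*`. -/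
noncomputable def rev : LeavittFree K V A →ₙₐ[K] (LeavittFree K V A)ᵐᵒᵖ :=
  lift fun g => MulOpposite.op (of K g.swap)

theorem rev_of (g : LeavittGen V A) :
    (rev (of K g)).unop = of K g.swap := by
  simp [rev, lift_of]

theorem rev_rev (x : LeavittFree K V A) : (rev (rev x).unop).unop = x := by
  let φ : LeavittFree K V A →ₙₐ[K] LeavittFree K V A :=
    { toFun := fun y => (rev (rev y).unop).unop
      map_smul' := fun k y => by simp
      map_zero' := by simp
      map_add' := fun y z => by simp
      map_mul' := fun y z => by simp }
  have h : φ = NonUnitalAlgHom.id K (LeavittFree K V A) :=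
    hom_ext fun g => by
      change (rev (rev (of K g)).unop).unop = of K g
      rw [rev_of, rev_of, LeavittGen.swap_swap]
  exact DFunLike.congr_fun h x

end LeavittFree

section Relations

variable (K : Type*) {V A : Type*} [Field K] (G : DirectedGraph V A)

open LeavittGen LeavittFree in
/-- The defining relations of the Leavitt path algebra. -/
inductive LeavittRel : LeavittFree K V A → LeavittFree K V A → Prop
  | vv (v : V) : LeavittRel (of K (vtx v) * of K (vtx v)) (of K (vtx v))
  | vw (v w : V) (h : v ≠ w) : LeavittRel (of K (vtx v) * of K (vtx w)) 0
  | source_edge (e : A) : LeavittRel (of K (vtx (G.source e)) * of K (edge e)) (of K (edge e))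
  | edge_range (e : A) : LeavittRel (of K (edge e) * of K (vtx (G.range e))) (of K (edge e))
  | range_ghost (e : A) : LeavittRel (of K (vtx (G.range e)) * of K (ghost e)) (of K (ghost e))
  | ghost_source (e : A) : LeavittRel (of K (ghost e) * of K (vtx (G.source e))) (of K (ghost e))
  | ck1_same (e : A) : LeavittRel (of K (ghost e) * of K (edge e)) (of K (vtx (G.range e)))
  | ck1_ne (e f : A) (h : e ≠ f) : LeavittRel (of K (ghost e) * of K (edge f)) 0
  | ck2 (v : V) (F : Finset A) (hF : ∀ e, e ∈ F ↔ G.source e = v) (hne : F.Nonempty) :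
      LeavittRel (of K (vtx v)) (∑ e ∈ F, of K (edge e) * of K (ghost e))

/-- The congruence of the non-unital `K`-algebra generated by the relations. (The scalar multiples
of the relations are included, as there is no unit through which they would come for free.) -/
noncomputable def leavittCon : RingCon (LeavittFree K V A) :=
  ringConGen fun x y => ∃ (k : K) (a b : LeavittFree K V A),
    LeavittRel K G a b ∧ x = k • a ∧ y = k • b

/-- The Leavitt path algebra `L_K(E)`, an associative `K`-algebra which need not have a unit. -/
def LeavittPathAlgebra : Type _ :=
  (leavittCon K G).Quotient

noncomputable instance : NonUnitalRing (LeavittPathAlgebra K G) :=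
  inferInstanceAs (NonUnitalRing (leavittCon K G).Quotient)

variable {K G}

theorem leavittCon_smul (k : K) {x y : LeavittFree K V A} (h : leavittCon K G x y) :
    leavittCon K G (k • x) (k • y) := by
  change RingConGen.Rel _ x y at h
  induction h with
  | of x y h =>
    obtain ⟨l, a, b, hab, rfl, rfl⟩ := h
    exact RingConGen.Rel.of _ _ ⟨k * l, a, b, hab, by rw [mul_smul], by rw [mul_smul]⟩
  | refl x => exact (leavittCon K G).refl _
  | symm _ ih => exact (leavittCon K G).symm ih
  | trans _ _ ih₁ ih₂ => exact (leavittCon K G).trans ih₁ ih₂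
  | add _ _ ih₁ ih₂ =>
    rw [smul_add, smul_add]
    exact (leavittCon K G).add ih₁ ih₂
  | mul _ h₂ ih₁ _ =>
    rw [← smul_mul_assoc, ← smul_mul_assoc]
    exact (leavittCon K G).mul ih₁ h₂

open LeavittGen LeavittFree in
theorem leavittCon_rev {x y : LeavittFree K V A} (h : leavittCon K G x y) :
    leavittCon K G (rev x).unop (rev y).unop := by
  change RingConGen.Rel _ x y at h
  induction h with
  | of x y h =>
    obtain ⟨l, a, b, hab, rfl, rfl⟩ := h
    have key : ∀ {a b : LeavittFree K V A}, LeavittRel K G a b →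
        LeavittRel K G (rev a).unop (rev b).unop := by
      intro a b hab
      cases hab <;>
        simp only [map_mul, map_zero, map_sum, MulOpposite.unop_mul, MulOpposite.unop_zero,
          Finset.unop_sum, rev_of, swap]
      · exact .vv _
      · exact .vw _ _ (Ne.symm ‹_›)
      · exact .ghost_source _
      · exact .range_ghost _
      · exact .edge_range _
      · exact .source_edge _
      · exact .ck1_same _
      · exact .ck1_ne _ _ (Ne.symm ‹_›)
      · exact .ck2 _ _ ‹_› ‹_›
    refine RingConGen.Rel.of _ _ ⟨l, _, _, key hab, ?_, ?_⟩ <;> simp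
  | refl x => exact (leavittCon K G).refl _
  | symm _ ih => exact (leavittCon K G).symm ih
  | trans _ _ ih₁ ih₂ => exact (leavittCon K G).trans ih₁ ih₂
  | add _ _ ih₁ ih₂ =>
    simp only [map_add, MulOpposite.unop_add]
    exact (leavittCon K G).add ih₁ ih₂
  | mul _ _ ih₁ ih₂ =>
    simp only [map_mul, MulOpposite.unop_mul]
    exact (leavittCon K G).mul ih₂ ih₁

namespace LeavittPathAlgebra

variable (K G) in
/-- The quotient map from the free algebra. -/
noncomputable def mk (x : LeavittFree K V A) : LeavittPathAlgebra K G :=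
  (x : (leavittCon K G).Quotient)

theorem mk_surjective : Function.Surjective (mk K G) := Quotient.mk''_surjective

theorem mk_eq {x y : LeavittFree K V A} : mk K G x = mk K G y ↔ leavittCon K G x y :=
  RingCon.eq _

theorem mk_rel {x y : LeavittFree K V A} (h : LeavittRel K G x y) : mk K G x = mk K G y :=
  mk_eq.2 (RingConGen.Rel.of _ _ ⟨1, x, y, h, (one_smul K x).symm, (one_smul K y).symm⟩)

theorem mk_add (x y : LeavittFree K V A) : mk K G (x + y) = mk K G x + mk K G y := rfl

theorem mk_mul (x y : LeavittFree K V A) : mk K G (x * y) = mk K G x * mk K G y := rfl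

theorem mk_zero : mk K G 0 = 0 := rfl

noncomputable instance : SMul K (LeavittPathAlgebra K G) where
  smul k := Quotient.map' (k • ·) fun _ _ h => leavittCon_smul k h

theorem mk_smul (k : K) (x : LeavittFree K V A) : mk K G (k • x) = k • mk K G x := rfl

noncomputable instance : Module K (LeavittPathAlgebra K G) where
  one_smul x := by
    obtain ⟨x, rfl⟩ := mk_surjective x
    rw [← mk_smul, one_smul]
  mul_smul a b x := by
    obtain ⟨x, rfl⟩ := mk_surjective x
    rw [← mk_smul, ← mk_smul, ← mk_smul, mul_smul]
  smul_zero a := by rw [← mk_zero, ← mk_smul, smul_zero]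
  smul_add a x y := by
    obtain ⟨x, rfl⟩ := mk_surjective x
    obtain ⟨y, rfl⟩ := mk_surjective y
    rw [← mk_add, ← mk_smul, ← mk_smul, ← mk_smul, ← mk_add, smul_add]
  add_smul a b x := by
    obtain ⟨x, rfl⟩ := mk_surjective x
    rw [← mk_smul, ← mk_smul, ← mk_smul, ← mk_add, add_smul]
  zero_smul x := by
    obtain ⟨x, rfl⟩ := mk_surjective x
    rw [← mk_smul, zero_smul, mk_zero]

instance : IsScalarTower K (LeavittPathAlgebra K G) (LeavittPathAlgebra K G) where
  smul_assoc a x y := by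
    obtain ⟨x, rfl⟩ := mk_surjective x
    obtain ⟨y, rfl⟩ := mk_surjective y
    rw [smul_eq_mul, smul_eq_mul, ← mk_smul, ← mk_mul, ← mk_mul, ← mk_smul, smul_mul_assoc]

instance : SMulCommClass K (LeavittPathAlgebra K G) (LeavittPathAlgebra K G) where
  smul_comm a x y := by
    obtain ⟨x, rfl⟩ := mk_surjective x
    obtain ⟨y, rfl⟩ := mk_surjective y
    rw [smul_eq_mul, smul_eq_mul, ← mk_smul, ← mk_mul, ← mk_mul, ← mk_smul, mul_smul_comm]

/-- The standard involution. -/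
noncomputable instance : Star (LeavittPathAlgebra K G) where
  star := Quotient.map' (fun x => (LeavittFree.rev x).unop) fun _ _ h => leavittCon_rev h

theorem star_mk (x : LeavittFree K V A) :
    star (mk K G x) = mk K G (LeavittFree.rev x).unop := rfl

noncomputable instance : StarRing (LeavittPathAlgebra K G) where
  star_involutive x := by
    obtain ⟨x, rfl⟩ := mk_surjective x
    rw [star_mk, star_mk, LeavittFree.rev_rev]
  star_mul x y := by
    obtain ⟨x, rfl⟩ := mk_surjective x
    obtain ⟨y, rfl⟩ := mk_surjective y
    rw [← mk_mul, star_mk, star_mk, star_mk, ← mk_mul, map_mul, MulOpposite.unop_mul]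
  star_add x y := by
    obtain ⟨x, rfl⟩ := mk_surjective x
    obtain ⟨y, rfl⟩ := mk_surjective y
    rw [← mk_add, star_mk, star_mk, star_mk, ← mk_add, map_add, MulOpposite.unop_add]

/-- The standard involution is `K`-linear. -/
theorem star_smul_eq (k : K) (x : LeavittPathAlgebra K G) : star (k • x) = k • star x := by
  obtain ⟨x, rfl⟩ := mk_surjective x
  rw [← mk_smul, star_mk, star_mk, ← mk_smul, map_smul, MulOpposite.unop_smul]

variable (K G) in
/-- A vertex as an element of the algebra. -/
noncomputable def vtx (v : V) : LeavittPathAlgebra K G :=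
  mk K G (LeavittFree.of K (.vtx v))

variable (K G) in
/-- An edge as an element of the algebra. -/
noncomputable def edge (e : A) : LeavittPathAlgebra K G :=
  mk K G (LeavittFree.of K (.edge e))

variable (K G) in
/-- A ghost edge `e*` as an element of the algebra. -/
noncomputable def ghost (e : A) : LeavittPathAlgebra K G :=
  mk K G (LeavittFree.of K (.ghost e))

theorem star_vtx (v : V) : star (vtx K G v) = vtx K G v := by
  rw [vtx, star_mk, LeavittFree.rev_of, LeavittGen.swap]

theorem star_edge (e : A) : star (edge K G e) = ghost K G e := by
  rw [edge, star_mk, LeavittFree.rev_of, LeavittGen.swap, ghost]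

theorem star_ghost (e : A) : star (ghost K G e) = edge K G e := by
  rw [ghost, star_mk, LeavittFree.rev_of, LeavittGen.swap, edge]

variable (K G) in
/-- The product `e₁ ⋯ eₙ · w` of a list of edges and the final vertex `w`. -/
noncomputable def ofWalk (w : V) : List A → LeavittPathAlgebra K G
  | [] => vtx K G w
  | e :: es => edge K G e * ofWalk w es

variable (K) in
/-- The element of the algebra given by a path. The ghost path `p*` is then `star (ofPath K p)`. -/
noncomputable def ofPath (p : G.Path) : LeavittPathAlgebra K G :=
  ofWalk K G p.tgt p.edges

theorem ofPath_edge (e : A) (h : G.IsWalk (G.source e) [e] (G.range e)) :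
    ofPath K (⟨G.source e, G.range e, [e], h⟩ : G.Path) = edge K G e :=
  mk_rel (.edge_range e)

variable (K G) in
/-- The set of skew-symmetric elements with respect to the standard involution. -/
noncomputable def skewElements : Set (LeavittPathAlgebra K G) :=
  {x | star x = -x}

variable (K G) in
/-- The commutator subspace `[L_K(E), L_K(E)]`. -/
noncomputable def commutators : Submodule K (LeavittPathAlgebra K G) :=
  Submodule.span K {z | ∃ a b : LeavittPathAlgebra K G, z = a * b - b * a}

end LeavittPathAlgebra

end Relations

/-! ### Normal forms -/

/-- The data (with the side conditions) of an expression
`∑ᵢ bᵢ (tᵢ qᵢ* - qᵢ tᵢ*) + ∑ᵢ ∑ⱼ cᵢⱼ (xᵢⱼ yᵢⱼ* xᵢⱼ* - xᵢⱼ yᵢⱼ xᵢⱼ*)`: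
the paths `tᵢ`, `qᵢ` do not differ by a closed path, the `yᵢⱼ` are closed paths of positive length,
and `yᵢⱼ ∼ yᵢ'ⱼ'` if and only if `i = i'`. -/
structure SkewForm (K : Type*) {V A : Type*} [Field K] (G : DirectedGraph V A) where
  l : ℕ
  b : Fin l → K
  t : Fin l → G.Path
  q : Fin l → G.Path
  tgt_eq : ∀ i, (t i).tgt = (q i).tgt
  q_ne : ∀ i, ∀ u : G.Path, u.IsClosed → ¬ (q i).IsConcat (t i) u
  t_ne : ∀ i, ∀ u : G.Path, u.IsClosed → ¬ (t i).IsConcat (q i) u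
  m : ℕ
  size : Fin m → ℕ
  size_pos : ∀ i, 0 < size i
  c : (i : Fin m) → Fin (size i) → K
  x : (i : Fin m) → Fin (size i) → G.Path
  y : (i : Fin m) → Fin (size i) → G.Path
  x_tgt : ∀ i j, (x i j).tgt = (y i j).src
  y_closed : ∀ i j, (y i j).IsNontrivialClosed
  y_rotates : ∀ i j i' j', (y i j).Rotates (y i' j') ↔ i = i'

/-- The element of `L_K(E)` written by the expression. -/
noncomputable def SkewForm.value {K V A : Type*} [Field K] {G : DirectedGraph V A}
    (D : SkewForm K G) : LeavittPathAlgebra K G :=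
  letI P : G.Path → LeavittPathAlgebra K G := LeavittPathAlgebra.ofPath K
  (∑ i, D.b i • (P (D.t i) * star (P (D.q i)) - P (D.q i) * star (P (D.t i)))) +
    ∑ i, ∑ j, D.c i j •
      (P (D.x i j) * star (P (D.y i j)) * star (P (D.x i j)) -
        P (D.x i j) * P (D.y i j) * star (P (D.x i j)))

/-- The condition `∑ⱼ cᵢⱼ = 0` for every `i`. -/
def SkewForm.IsBalanced {K V A : Type*} [Field K] {G : DirectedGraph V A}
    (D : SkewForm K G) : Prop :=
  ∀ i, ∑ j, D.c i j = 0

/-! The algebra is spanned by the products p q* with r(p) = r(q) (`span_monos`), and the involution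
exchanges p q* and q p*. So every a - a* is a combination of differences p q* - q p*. Such a
difference is a pair term of a skew form unless one path extends the other by a closed path u; then
it is, up to sign, p u* p* - p u p* for the shorter path p, or 0 if u is a vertex (`sub_star_mem`).
If 2 is invertible, a skew x equals (x - x*)/2, and the description of the skew elements follows. In
characteristic 2 a skew x is symmetric, and a combination of elements p p* has to be split off first
(`exists_eq_diag_add`).

Modulo commutators p p* becomes r(p), a pair term becomes 0, and x y x* becomes y, which depends
only on the rotation class of y. Hence balanced skew forms vanish (`value_mem_commutators`), and the
diagonal part becomes a combination of vertices that vanishes as soon as its coefficient vector lies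
in the span of the B_v, by the relation v = ∑ e e* (`diag_mem_commutators`).

For the converse one needs linear maps that kill commutators (`exists_trace`). One is built from any
function of closed paths which is invariant under rotation and additive along v = ∑ e e* on
vertices. The indicator of a rotation class reads off ∑ⱼ cᵢⱼ; the class of a vertex in K^(E⁰) modulo
the span of the B_v reads off the diagonal condition. Thus every expression of an element of [L, L]
satisfies the stated conditions, not just a well-chosen one.

The products p q* are linearly dependent, because p q* = ∑ (p e)(q e)* at regular vertices. Linear
maps are therefore defined by functions that respect this relation (`exists_linearMap`): L acts on
such functions by right translation, and the map sends x to the value of the translate by x at a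
formal unit. -/

namespace DirectedGraph

/-! ### Paths as lists of edges with a given end -/

variable {V A : Type*} (G : DirectedGraph V A)

/-- The vertex at which the list of edges `p`, followed to `w`, starts. -/
def startOf (w : V) : List A → V
  | [] => w
  | e :: _ => G.source e

/-- The list of edges `p` is a path which ends at `w`. -/
def IsWalkTo (p : List A) (w : V) : Prop := G.IsWalk (G.startOf w p) p w

variable {G}

@[simp]
theorem startOf_nil (w : V) : G.startOf w [] = w := rfl

@[simp]
theorem startOf_cons (w : V) (e : A) (p : List A) : G.startOf w (e :: p) = G.source e := rfl

theorem IsWalk.startOf_eq {u w : V} {p : List A} (h : G.IsWalk u p w) : G.startOf w p = u := by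
  cases p with
  | nil => exact h.symm
  | cons e p => exact h.1

theorem IsWalk.isWalkTo {u w : V} {p : List A} (h : G.IsWalk u p w) : G.IsWalkTo p w := by
  rw [IsWalkTo, h.startOf_eq]
  exact h

theorem isWalkTo_nil (w : V) : G.IsWalkTo [] w := rfl

theorem isWalkTo_cons {e : A} {p : List A} {w : V} :
    G.IsWalkTo (e :: p) w ↔ G.startOf w p = G.range e ∧ G.IsWalkTo p w := by
  constructor
  · rintro ⟨-, h⟩
    exact ⟨h.startOf_eq, h.isWalkTo⟩
  · rintro ⟨h, h'⟩
    refine ⟨rfl, ?_⟩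
    rw [← h]
    exact h'

theorem isWalk_append {p q : List A} {u w : V} :
    G.IsWalk u (p ++ q) w ↔ ∃ x, G.IsWalk u p x ∧ G.IsWalk x q w := by
  induction p generalizing u with
  | nil => simp [IsWalk]
  | cons e p ih => simp [IsWalk, ih, and_assoc]

theorem startOf_concat (p : List A) (e : A) :
    G.startOf (G.range e) (p ++ [e]) = G.startOf (G.source e) p := by
  cases p <;> rfl

theorem isWalkTo_concat {p : List A} {e : A} :
    G.IsWalkTo (p ++ [e]) (G.range e) ↔ G.IsWalkTo p (G.source e) := by
  rw [IsWalkTo, IsWalkTo, startOf_concat, isWalk_append]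
  simp [IsWalk]

theorem Path.startOf_edges (p : G.Path) : G.startOf p.tgt p.edges = p.src :=
  p.isWalk.startOf_eq

theorem Path.isWalkTo (p : G.Path) : G.IsWalkTo p.edges p.tgt := p.isWalk.isWalkTo

/-- The path with given edges and given end. -/
def IsWalkTo.toPath {p : List A} {w : V} (h : G.IsWalkTo p w) : G.Path :=
  ⟨G.startOf w p, w, p, h⟩

theorem Path.ext_of_edges {p q : G.Path} (ht : p.tgt = q.tgt) (he : p.edges = q.edges) :
    p = q := by
  apply Path.ext _ ht he
  rw [← p.startOf_edges, ← q.startOf_edges, ht, he]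

end DirectedGraph

/-! ### Induction on elements and the universal property -/

namespace LeavittPathAlgebra

variable {K V A : Type*} [Field K] {G : DirectedGraph V A}

theorem induction_on {P : LeavittPathAlgebra K G → Prop} (x : LeavittPathAlgebra K G)
    (vtx : ∀ v, P (vtx K G v)) (edge : ∀ e, P (edge K G e)) (ghost : ∀ e, P (ghost K G e))
    (zero : P 0) (add : ∀ x y, P x → P y → P (x + y)) (smul : ∀ (k : K) x, P x → P (k • x))
    (mul : ∀ x y, P x → P y → P (x * y)) : P x := by
  obtain ⟨x, rfl⟩ := mk_surjective x
  have gen : ∀ g, P (mk K G (LeavittFree.of K g)) := by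
    rintro (v | e | e)
    · exact vtx v
    · exact edge e
    · exact ghost e
  have word : ∀ m : FreeSemigroup (LeavittGen V A), P (mk K G (MonoidAlgebra.single m 1)) := by
    intro m
    induction m using FreeSemigroup.recOnMul with
    | ih1 g => exact gen g
    | ih2 g m _ ih =>
      have : (MonoidAlgebra.single (FreeSemigroup.of g * m) 1 : LeavittFree K V A) =
          LeavittFree.of K g * MonoidAlgebra.single m 1 := by
        rw [LeavittFree.of, MonoidAlgebra.single_mul_single, one_mul]
      rw [this, mk_mul]
      exact mul _ _ (gen g) ih
  induction x using MonoidAlgebra.induction_linear with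
  | zero => exact zero
  | add x y hx hy => exact add _ _ hx hy
  | single m k =>
    have : (MonoidAlgebra.single m k : LeavittFree K V A) = k • MonoidAlgebra.single m 1 := by
      simp
    rw [this, mk_smul]
    exact smul _ _ (word m)

variable (K G) in
/-- The quotient map as a homomorphism of non-unital algebras. -/
noncomputable def mkₙₐ : LeavittFree K V A →ₙₐ[K] LeavittPathAlgebra K G where
  toFun := mk K G
  map_smul' := mk_smul
  map_zero' := mk_zero
  map_add' := mk_add
  map_mul' := mk_mul

section Lift

variable {B : Type*} [NonUnitalRing B] [Module K B] (f : LeavittFree K V A →ₙₐ[K] B)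

theorem eq_of_leavittCon (hf : ∀ a b, LeavittRel K G a b → f a = f b) {x y : LeavittFree K V A}
    (h : leavittCon K G x y) : f x = f y := by
  change RingConGen.Rel _ x y at h
  induction h with
  | of x y h =>
    obtain ⟨k, a, b, hab, rfl, rfl⟩ := h
    rw [map_smul, map_smul, hf a b hab]
  | refl x => rfl
  | symm _ ih => exact ih.symm
  | trans _ _ ih₁ ih₂ => exact ih₁.trans ih₂
  | add _ _ ih₁ ih₂ => rw [map_add, map_add, ih₁, ih₂]
  | mul _ _ ih₁ ih₂ => rw [map_mul, map_mul, ih₁, ih₂]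

/-- The universal property of the Leavitt path algebra. -/
noncomputable def lift (hf : ∀ a b, LeavittRel K G a b → f a = f b) :
    LeavittPathAlgebra K G →ₙₐ[K] B where
  toFun := Quotient.lift f fun _ _ h => eq_of_leavittCon f hf h
  map_smul' k x := by
    obtain ⟨x, rfl⟩ := mk_surjective x
    exact map_smul f k x
  map_zero' := map_zero f
  map_add' x y := by
    obtain ⟨x, rfl⟩ := mk_surjective x
    obtain ⟨y, rfl⟩ := mk_surjective y
    exact map_add f x y
  map_mul' x y := by
    obtain ⟨x, rfl⟩ := mk_surjective x
    obtain ⟨y, rfl⟩ := mk_surjective y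
    exact map_mul f x y

end Lift

/-! ### Multiplication of generators and paths -/

theorem vtx_mul_self (v : V) : vtx K G v * vtx K G v = vtx K G v := mk_rel (.vv v)

theorem vtx_mul_vtx_of_ne {v w : V} (h : v ≠ w) : vtx K G v * vtx K G w = 0 := mk_rel (.vw v w h)

theorem vtx_mul_edge (e : A) : vtx K G (G.source e) * edge K G e = edge K G e :=
  mk_rel (.source_edge e)

theorem edge_mul_vtx (e : A) : edge K G e * vtx K G (G.range e) = edge K G e :=
  mk_rel (.edge_range e)

theorem ghost_mul_vtx (e : A) : ghost K G e * vtx K G (G.source e) = ghost K G e :=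
  mk_rel (.ghost_source e)

theorem ghost_mul_edge (e : A) : ghost K G e * edge K G e = vtx K G (G.range e) :=
  mk_rel (.ck1_same e)

theorem ghost_mul_edge_of_ne {e f : A} (h : e ≠ f) : ghost K G e * edge K G f = 0 :=
  mk_rel (.ck1_ne e f h)

theorem vtx_eq_sum {v : V} (hv : G.IsRegular v) :
    vtx K G v = ∑ e ∈ hv.1.toFinset, edge K G e * ghost K G e := by
  have h := mk_rel (K := K) (G := G) (.ck2 v hv.1.toFinset (by simp) (by simpa using hv.2))
  change mkₙₐ K G _ = mkₙₐ K G _ at h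
  rw [map_sum] at h
  exact h

theorem ofWalk_nil (w : V) : ofWalk K G w [] = vtx K G w := rfl

theorem ofWalk_cons (w : V) (e : A) (p : List A) :
    ofWalk K G w (e :: p) = edge K G e * ofWalk K G w p := rfl

theorem star_ofWalk_nil (w : V) : star (ofWalk K G w []) = vtx K G w := star_vtx w

theorem star_ofWalk_cons (w : V) (e : A) (p : List A) :
    star (ofWalk K G w (e :: p)) = star (ofWalk K G w p) * ghost K G e := by
  rw [ofWalk_cons, star_mul, star_edge]

theorem vtx_mul_ofWalk_self (w : V) (p : List A) :
    vtx K G (G.startOf w p) * ofWalk K G w p = ofWalk K G w p := by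
  cases p with
  | nil => exact vtx_mul_self w
  | cons e p => rw [ofWalk_cons, ← mul_assoc, DirectedGraph.startOf, vtx_mul_edge]

theorem vtx_mul_ofWalk_of_ne {v w : V} {p : List A} (h : v ≠ G.startOf w p) :
    vtx K G v * ofWalk K G w p = 0 := by
  rw [← vtx_mul_ofWalk_self, ← mul_assoc, vtx_mul_vtx_of_ne h, zero_mul]

theorem edge_mul_ofWalk_of_ne {e : A} {w : V} {p : List A} (h : G.range e ≠ G.startOf w p) :
    edge K G e * ofWalk K G w p = 0 := by
  rw [← edge_mul_vtx, mul_assoc, vtx_mul_ofWalk_of_ne h, mul_zero]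

theorem ghost_mul_ofWalk_cons {e : A} {w : V} {p : List A} (h : G.startOf w p = G.range e) :
    ghost K G e * ofWalk K G w (e :: p) = ofWalk K G w p := by
  rw [ofWalk_cons, ← mul_assoc, ghost_mul_edge, ← h, vtx_mul_ofWalk_self]

theorem ghost_mul_ofWalk_cons_of_ne {e f : A} (h : e ≠ f) (w : V) (p : List A) :
    ghost K G e * ofWalk K G w (f :: p) = 0 := by
  rw [ofWalk_cons, ← mul_assoc, ghost_mul_edge_of_ne h, zero_mul]

theorem ofWalk_mul_vtx (w : V) (p : List A) :
    ofWalk K G w p * vtx K G w = ofWalk K G w p := by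
  induction p with
  | nil => exact vtx_mul_self w
  | cons e p ih => rw [ofWalk_cons, mul_assoc, ih]

theorem ofWalk_append {x : V} {p q : List A} (w : V) (h : G.startOf w q = x) :
    ofWalk K G w (p ++ q) = ofWalk K G x p * ofWalk K G w q := by
  induction p with
  | nil => rw [List.nil_append, ofWalk_nil, ← h, vtx_mul_ofWalk_self]
  | cons e p ih => rw [List.cons_append, ofWalk_cons, ih, ofWalk_cons, mul_assoc]

theorem ofWalk_singleton (e : A) : ofWalk K G (G.range e) [e] = edge K G e := edge_mul_vtx e

theorem ofWalk_concat (p : List A) (e : A) :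
    ofWalk K G (G.range e) (p ++ [e]) = ofWalk K G (G.source e) p * edge K G e := by
  rw [ofWalk_append _ rfl, ofWalk_singleton, DirectedGraph.startOf]

theorem star_ofWalk_mul_vtx_self (w : V) (p : List A) :
    star (ofWalk K G w p) * vtx K G (G.startOf w p) = star (ofWalk K G w p) := by
  rw [← star_vtx, ← star_mul, vtx_mul_ofWalk_self]

theorem star_ofWalk_mul_vtx_of_ne {v w : V} {p : List A} (h : v ≠ G.startOf w p) :
    star (ofWalk K G w p) * vtx K G v = 0 := by
  rw [← star_vtx, ← star_mul, vtx_mul_ofWalk_of_ne h, star_zero]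

theorem star_ofWalk_mul_ghost_of_ne {e : A} {w : V} {p : List A}
    (h : G.range e ≠ G.startOf w p) : star (ofWalk K G w p) * ghost K G e = 0 := by
  rw [← star_edge, ← star_mul, edge_mul_ofWalk_of_ne h, star_zero]

theorem star_ofWalk_mul_edge {e : A} {w : V} {p : List A} (h : G.startOf w p = G.range e) :
    star (ofWalk K G w (e :: p)) * edge K G e = star (ofWalk K G w p) := by
  rw [← star_ghost, ← star_mul, ghost_mul_ofWalk_cons h]

theorem star_ofWalk_mul_edge_of_ne {e f : A} (h : e ≠ f) (w : V) (p : List A) :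
    star (ofWalk K G w (f :: p)) * edge K G e = 0 := by
  rw [← star_ghost, ← star_mul, ghost_mul_ofWalk_cons_of_ne h, star_zero]

theorem vtx_mul_star_ofWalk (w : V) (p : List A) :
    vtx K G w * star (ofWalk K G w p) = star (ofWalk K G w p) := by
  rw [← star_vtx, ← star_mul, ofWalk_mul_vtx]

theorem star_ofWalk_mul_ofWalk (w : V) {p : List A} (hp : G.IsWalkTo p w) :
    star (ofWalk K G w p) * ofWalk K G w p = vtx K G w := by
  induction p with
  | nil => rw [star_ofWalk_nil, ofWalk_nil, vtx_mul_self]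
  | cons e p ih =>
    obtain ⟨h, hp⟩ := DirectedGraph.isWalkTo_cons.1 hp
    rw [star_ofWalk_cons, mul_assoc, ghost_mul_ofWalk_cons h, ih hp]

/-- If `p* q ≠ 0`, then one of the paths `p` and `q` is an initial segment of the other. -/
theorem star_ofWalk_mul_ofWalk_eq_zero {w x : V} {p q : List A} (hp : G.IsWalkTo p w)
    (hq : G.IsWalkTo q x)
    (h₁ : ¬ (p <+: q ∧ G.startOf w p = G.startOf x q))
    (h₂ : ¬ (q <+: p ∧ G.startOf w p = G.startOf x q)) :
    star (ofWalk K G w p) * ofWalk K G x q = 0 := by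
  induction p generalizing q with
  | nil =>
    rw [star_ofWalk_nil]
    exact vtx_mul_ofWalk_of_ne fun h => h₁ ⟨List.nil_prefix, h⟩
  | cons e p ih =>
    cases q with
    | nil =>
      rw [ofWalk_nil]
      exact star_ofWalk_mul_vtx_of_ne fun h => h₂ ⟨List.nil_prefix, h.symm⟩
    | cons f q =>
      rw [star_ofWalk_cons, mul_assoc]
      by_cases hef : e = f
      · subst hef
        obtain ⟨hp', hp⟩ := DirectedGraph.isWalkTo_cons.1 hp
        obtain ⟨hq', hq⟩ := DirectedGraph.isWalkTo_cons.1 hq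
        rw [ghost_mul_ofWalk_cons hq']
        refine ih hp hq (fun h => h₁ ⟨?_, rfl⟩) fun h => h₂ ⟨?_, rfl⟩
        · exact (List.prefix_cons_inj e).2 h.1
        · exact (List.prefix_cons_inj e).2 h.1
      · rw [ghost_mul_ofWalk_cons_of_ne hef, mul_zero]

/-! ### The algebra is spanned by the products `p q*` -/

variable (K G) in
/-- The product `p q*` of a path and a ghost path which end at `w`. -/
noncomputable def mono (w : V) (p q : List A) : LeavittPathAlgebra K G :=
  ofWalk K G w p * star (ofWalk K G w q)

theorem star_mono (w : V) (p q : List A) : star (mono K G w p q) = mono K G w q p := by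
  rw [mono, star_mul, star_star, mono]

variable (K G) in
/-- The products `p q*` of paths and ghost paths with a common end. -/
def monos : Set (LeavittPathAlgebra K G) :=
  {x | ∃ w p q, G.IsWalkTo p w ∧ G.IsWalkTo q w ∧ x = mono K G w p q}

-- The only case that lengthens the ghost part is a ghost edge meeting p of length 0: there e* q* =
-- (q e)*, which forces the common end to move from s(e) to r(e).
open DirectedGraph in
theorem generator_mul_mono_mem (g : LeavittGen V A) {x : LeavittPathAlgebra K G}
    (hx : x ∈ monos K G) :
    mk K G (LeavittFree.of K g) * x ∈ Submodule.span K (monos K G) := by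
  classical
  obtain ⟨w, p, q, hp, hq, rfl⟩ := hx
  rw [mono, ← mul_assoc]
  rcases g with v | e | e
  · change vtx K G v * _ * _ ∈ _
    by_cases h : v = G.startOf w p
    · rw [h, vtx_mul_ofWalk_self]
      exact Submodule.subset_span ⟨w, p, q, hp, hq, rfl⟩
    · rw [vtx_mul_ofWalk_of_ne h, zero_mul]
      exact zero_mem _
  · change edge K G e * _ * _ ∈ _
    by_cases h : G.range e = G.startOf w p
    · exact Submodule.subset_span ⟨w, e :: p, q, isWalkTo_cons.2 ⟨h.symm, hp⟩, hq, rfl⟩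
    · rw [edge_mul_ofWalk_of_ne h, zero_mul]
      exact zero_mem _
  · change ghost K G e * _ * _ ∈ _
    cases p with
    | nil =>
      by_cases h : w = G.source e
      · subst h
        rw [ofWalk_nil, ghost_mul_vtx]
        refine Submodule.subset_span
          ⟨G.range e, [], q ++ [e], rfl, isWalkTo_concat.2 hq, ?_⟩
        rw [mono, ofWalk_nil, vtx_mul_star_ofWalk, ofWalk_concat, star_mul, star_edge]
      · rw [ofWalk_nil, ← ghost_mul_vtx, mul_assoc (ghost K G e), vtx_mul_vtx_of_ne (Ne.symm h),
          mul_zero, zero_mul]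
        exact zero_mem _
    | cons f p =>
      by_cases h : e = f
      · subst h
        obtain ⟨h, hp⟩ := isWalkTo_cons.1 hp
        rw [ghost_mul_ofWalk_cons h]
        exact Submodule.subset_span ⟨w, p, q, hp, hq, rfl⟩
      · rw [ghost_mul_ofWalk_cons_of_ne h, zero_mul]
        exact zero_mem _

/-- The span is stable under left multiplication by generators and contains the vertices, hence also
e = e r(e) and e* = e* s(e). The induction carries membership and stability together, since a
product x y needs stability for x and membership of y. -/
theorem span_monos : Submodule.span K (monos K G) = ⊤ := by
  have key : ∀ x : LeavittPathAlgebra K G, x ∈ Submodule.span K (monos K G) ∧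
      ∀ y ∈ Submodule.span K (monos K G), x * y ∈ Submodule.span K (monos K G) := by
    intro x
    have gen : ∀ g, ∀ y ∈ Submodule.span K (monos K G),
        mk K G (LeavittFree.of K g) * y ∈ Submodule.span K (monos K G) := by
      intro g y hy
      induction hy using Submodule.span_induction with
      | mem y hy => exact generator_mul_mono_mem g hy
      | zero => rw [mul_zero]; exact zero_mem _
      | add y z _ _ hy hz => rw [mul_add]; exact add_mem hy hz
      | smul k y _ hy => rw [mul_smul_comm]; exact Submodule.smul_mem _ k hy
    have vtx_mem : ∀ v, vtx K G v ∈ Submodule.span K (monos K G) := fun v =>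
      Submodule.subset_span ⟨v, [], [], rfl, rfl, by
        rw [mono, star_ofWalk_nil, ofWalk_nil, vtx_mul_self]⟩
    induction x using induction_on with
    | vtx v => exact ⟨vtx_mem v, gen (.vtx v)⟩
    | edge e =>
      refine ⟨?_, gen (.edge e)⟩
      rw [← edge_mul_vtx]
      exact gen (.edge e) _ (vtx_mem _)
    | ghost e =>
      refine ⟨?_, gen (.ghost e)⟩
      rw [← ghost_mul_vtx]
      exact gen (.ghost e) _ (vtx_mem _)
    | zero => exact ⟨zero_mem _, fun y _ => by rw [zero_mul]; exact zero_mem _⟩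
    | add x y hx hy =>
      exact ⟨add_mem hx.1 hy.1, fun z hz => by
        rw [add_mul]; exact add_mem (hx.2 z hz) (hy.2 z hz)⟩
    | smul k x hx =>
      exact ⟨Submodule.smul_mem _ k hx.1, fun z hz => by
        rw [smul_mul_assoc]; exact Submodule.smul_mem _ k (hx.2 z hz)⟩
    | mul x y hx hy =>
      exact ⟨hx.2 y hy.1, fun z hz => by rw [mul_assoc]; exact hx.2 _ (hy.2 z hz)⟩
  exact eq_top_iff.2 fun x _ => (key x).1

/-- Two linear maps which agree on the products `p q*` are equal. -/
theorem linearMap_ext {M : Type*} [AddCommGroup M] [Module K M]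
    {f g : LeavittPathAlgebra K G →ₗ[K] M}
    (h : ∀ w p q, G.IsWalkTo p w → G.IsWalkTo q w → f (mono K G w p q) = g (mono K G w p q)) :
    f = g := by
  apply LinearMap.ext_on span_monos
  rintro _ ⟨w, p, q, hp, hq, rfl⟩
  exact h w p q hp hq

end LeavittPathAlgebra

/-! ### Linear maps with prescribed values on the products `p q*` -/

namespace LeavittPathAlgebra

variable {K V A : Type*} [Field K] (G : DirectedGraph V A)

section Harmonic

variable (K) (M : Type*) [AddCommGroup M] [Module K M]

/-- A function `Φ` on the triples `(p, q, w)`, which stand for `p q*` where `p` and `q` end at `w`,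
with an additional value at a formal unit, is harmonic if it is supported on paths `q` and respects
the relation `p q* = ∑ e, (p e) (q e)*` at regular vertices. -/
def harmonic : Submodule K (M × (List A → List A → V → M)) where
  carrier := {Φ | (∀ p q w, ¬ G.IsWalkTo q w → Φ.2 p q w = 0) ∧
    ∀ w (hw : G.IsRegular w) p q,
      Φ.2 p q w = ∑ e ∈ hw.1.toFinset, Φ.2 (p ++ [e]) (q ++ [e]) (G.range e)}
  add_mem' {Φ Ψ} hΦ hΨ := by
    refine ⟨fun p q w h => ?_, fun w hw p q => ?_⟩
    · simp [hΦ.1 p q w h, hΨ.1 p q w h]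
    · simp [hΦ.2 w hw p q, hΨ.2 w hw p q, Finset.sum_add_distrib]
  zero_mem' := by simp
  smul_mem' k Φ hΦ := by
    refine ⟨fun p q w h => ?_, fun w hw p q => ?_⟩
    · simp [hΦ.1 p q w h]
    · simp [hΦ.2 w hw p q, Finset.smul_sum]

variable {M}

open Classical in
/-- The value at `p q*` of the translate of `Φ` by a generator, that is, the value of `Φ` at the
product of `p q*` with the generator. -/
noncomputable def translateFun (Φ : M × (List A → List A → V → M)) :
    LeavittGen V A → List A → List A → V → M
  | .vtx v, p, q, w => if G.startOf w q = v then Φ.2 p q w else 0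
  | .edge e, p, [], w => if G.source e = w then Φ.2 (p ++ [e]) [] (G.range e) else 0
  | .edge e, p, f :: q, w => if f = e ∧ G.startOf w q = G.range e then Φ.2 p q w else 0
  | .ghost e, p, q, w => Φ.2 p (e :: q) w

/-- The value at the formal unit of the translate of `Φ` by a generator. -/
def translateOne (Φ : M × (List A → List A → V → M)) : LeavittGen V A → M
  | .vtx v => Φ.2 [] [] v
  | .edge e => Φ.2 [e] [] (G.range e)
  | .ghost e => Φ.2 [] [e] (G.range e)

variable (M)

/-- Right translation by a generator on all functions. -/
noncomputable def translate (g : LeavittGen V A) :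
    Module.End K (M × (List A → List A → V → M)) where
  toFun Φ := (translateOne G Φ g, translateFun G Φ g)
  map_add' Φ Ψ := by
    ext p q w
    · cases g <;> rfl
    · rcases g with v | e | e <;> rcases q with _ | ⟨f, q⟩ <;>
        simp only [translateFun, Prod.snd_add, Pi.add_apply] <;> split_ifs <;> simp
  map_smul' k Φ := by
    ext p q w
    · cases g <;> rfl
    · rcases g with v | e | e <;> rcases q with _ | ⟨f, q⟩ <;>
        simp only [translateFun, Prod.smul_snd, Pi.smul_apply, RingHom.id_apply] <;>
        split_ifs <;> simp

-- Right multiplication by a generator commutes with continuing p and q by the same edge, as it acts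
-- at the initial end of q. The exception is an edge e acting on q of length 0.
open DirectedGraph in
theorem translate_mem (g : LeavittGen V A) (Φ : M × (List A → List A → V → M))
    (hΦ : Φ ∈ harmonic K G M) : translate K G M g Φ ∈ harmonic K G M := by
  classical
  obtain ⟨h₁, h₂⟩ := hΦ
  have src : ∀ {w : V} (hw : G.IsRegular w) {e : A}, e ∈ hw.1.toFinset → G.source e = w := by
    intro w hw e he
    simpa using he
  refine ⟨fun p q w h => ?_, fun w hw p q => ?_⟩
  · change translateFun G Φ g p q w = 0
    rcases g with v | e | e
    · simp [translateFun, h₁ p q w h]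
    · cases q with
      | nil => exact absurd rfl h
      | cons f q =>
        rw [translateFun, ite_eq_right_iff]
        rintro ⟨rfl, hq⟩
        exact h₁ _ _ _ fun hq' => h (isWalkTo_cons.2 ⟨hq, hq'⟩)
    · exact h₁ _ _ _ fun h' => h (isWalkTo_cons.1 h').2
  · change translateFun G Φ g p q w =
      ∑ e ∈ hw.1.toFinset, translateFun G Φ g (p ++ [e]) (q ++ [e]) (G.range e)
    rcases g with v | e | e
    · have h : ∀ e ∈ hw.1.toFinset,
          translateFun G Φ (.vtx v) (p ++ [e]) (q ++ [e]) (G.range e) =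
            if G.startOf w q = v then Φ.2 (p ++ [e]) (q ++ [e]) (G.range e) else 0 := by
        intro e he
        rw [translateFun, startOf_concat, src hw he]
      rw [Finset.sum_congr rfl h, translateFun, h₂ w hw p q]
      split_ifs <;> simp
    · cases q with
      | nil =>
        -- This is p (∑ g g*) e = p e: only the summand g = e survives.
        simp only [translateFun, List.nil_append, startOf_nil]
        split_ifs with he
        · rw [Finset.sum_eq_single_of_mem e (by simpa using he)]
          · simp
          · intro f _ hfe
            simp [hfe]
        · refine (Finset.sum_eq_zero fun f hf => if_neg ?_).symm
          rintro ⟨rfl, -⟩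
          exact he (src hw hf)
      | cons f q =>
        have h : ∀ g ∈ hw.1.toFinset,
            translateFun G Φ (.edge e) (p ++ [g]) (f :: q ++ [g]) (G.range g) =
              if f = e ∧ G.startOf w q = G.range e then
                Φ.2 (p ++ [g]) (q ++ [g]) (G.range g) else 0 := by
          intro g hg
          rw [List.cons_append, translateFun, startOf_concat, src hw hg]
        rw [Finset.sum_congr rfl h, translateFun, h₂ w hw p q]
        split_ifs <;> simp
    · exact h₂ w hw p (e :: q)

/-- Right translation by a generator on harmonic functions. -/
noncomputable def act (g : LeavittGen V A) : Module.End K (harmonic K G M) :=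
  (translate K G M g).restrict (translate_mem K G M g)

variable {K G M}

@[simp]
theorem act_vtx_one (v : V) (Φ : harmonic K G M) :
    (act K G M (.vtx v) Φ).1.1 = Φ.1.2 [] [] v := rfl

@[simp]
theorem act_edge_one (e : A) (Φ : harmonic K G M) :
    (act K G M (.edge e) Φ).1.1 = Φ.1.2 [e] [] (G.range e) := rfl

@[simp]
theorem act_ghost_one (e : A) (Φ : harmonic K G M) :
    (act K G M (.ghost e) Φ).1.1 = Φ.1.2 [] [e] (G.range e) := rfl

open Classical in
@[simp]
theorem act_vtx (v : V) (Φ : harmonic K G M) (p q : List A) (w : V) :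
    (act K G M (.vtx v) Φ).1.2 p q w = if G.startOf w q = v then Φ.1.2 p q w else 0 := rfl

open Classical in
theorem act_vtx_nil (v : V) (Φ : harmonic K G M) (p : List A) (w : V) :
    (act K G M (.vtx v) Φ).1.2 p [] w = if w = v then Φ.1.2 p [] w else 0 := rfl

open Classical in
theorem act_vtx_cons (v : V) (Φ : harmonic K G M) (f : A) (p q : List A) (w : V) :
    (act K G M (.vtx v) Φ).1.2 p (f :: q) w =
      if G.source f = v then Φ.1.2 p (f :: q) w else 0 := rfl

open Classical in
@[simp]
theorem act_edge_nil (e : A) (Φ : harmonic K G M) (p : List A) (w : V) :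
    (act K G M (.edge e) Φ).1.2 p [] w =
      if G.source e = w then Φ.1.2 (p ++ [e]) [] (G.range e) else 0 := rfl

open Classical in
@[simp]
theorem act_edge_cons (e f : A) (Φ : harmonic K G M) (p q : List A) (w : V) :
    (act K G M (.edge e) Φ).1.2 p (f :: q) w =
      if f = e ∧ G.startOf w q = G.range e then Φ.1.2 p q w else 0 := rfl

@[simp]
theorem act_ghost (e : A) (Φ : harmonic K G M) (p q : List A) (w : V) :
    (act K G M (.ghost e) Φ).1.2 p q w = Φ.1.2 p (e :: q) w := rfl

theorem harmonic_ext {Φ Ψ : harmonic K G M} (h₁ : Φ.1.1 = Ψ.1.1)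
    (h₂ : ∀ p q w, G.IsWalkTo q w → Φ.1.2 p q w = Ψ.1.2 p q w) : Φ = Ψ := by
  apply Subtype.ext
  apply Prod.ext h₁
  funext p q w
  by_cases hq : G.IsWalkTo q w
  · exact h₂ p q w hq
  · rw [Φ.2.1 p q w hq, Ψ.2.1 p q w hq]

-- Each relation is checked at the formal unit and at all p q*. Harmonicity is what makes v = ∑ e e*
-- hold at the unit and at q of length 0; for longer q only the first edge of q contributes. The
-- support condition on q gives r(e) e* = e*.
open DirectedGraph in
theorem lift_act_rel (a b : LeavittFree K V A) (h : LeavittRel K G a b) :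
    LeavittFree.lift (act K G M) a = LeavittFree.lift (act K G M) b := by
  classical
  induction h with
  | vv v =>
    simp only [map_mul, LeavittFree.lift_of]
    refine LinearMap.ext fun Φ => harmonic_ext ?_ fun p q w hq => ?_
    · simp
    · simp only [Module.End.mul_apply, act_vtx]
      split_ifs <;> rfl
  | vw v w h =>
    simp only [map_mul, map_zero, LeavittFree.lift_of]
    refine LinearMap.ext fun Φ => harmonic_ext ?_ fun p q w hq => ?_
    · simp [h]
    · simp only [Module.End.mul_apply, act_vtx]
      split_ifs with h₁ h₂
      · exact absurd (h₁.symm.trans h₂) h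
      · rfl
      · rfl
  | source_edge e =>
    simp only [map_mul, LeavittFree.lift_of]
    refine LinearMap.ext fun Φ => harmonic_ext ?_ fun p q w hq => ?_
    · simp
    · rcases q with _ | ⟨f, q⟩
      · simp only [Module.End.mul_apply, act_vtx_nil, act_edge_nil]
        split_ifs with h₁ h₂ h₃
        · rfl
        · exact absurd h₁.symm h₂
        · exact absurd h₃.symm h₁
        · rfl
      · simp only [Module.End.mul_apply, act_vtx_cons, act_edge_cons]
        split_ifs with h₁ h₂ h₃
        · rfl
        · rfl
        · exact absurd (congrArg G.source h₃.1) h₁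
        · rfl
  | edge_range e =>
    simp only [map_mul, LeavittFree.lift_of]
    refine LinearMap.ext fun Φ => harmonic_ext ?_ fun p q w hq => ?_
    · simp
    · rcases q with _ | ⟨f, q⟩
      · simp
      · simp only [Module.End.mul_apply, act_vtx, act_edge_cons]
        split_ifs with h₁ h₂
        · rfl
        · exact absurd h₁.2 h₂
        · rfl
  | range_ghost e =>
    simp only [map_mul, LeavittFree.lift_of]
    refine LinearMap.ext fun Φ => harmonic_ext ?_ fun p q w hq => ?_
    · simp
    · simp only [Module.End.mul_apply, act_vtx, act_ghost]
      split_ifs with h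
      · rfl
      · exact (Φ.2.1 _ _ _ fun h' => h (isWalkTo_cons.1 h').1).symm
  | ghost_source e =>
    simp only [map_mul, LeavittFree.lift_of]
    refine LinearMap.ext fun Φ => harmonic_ext ?_ fun p q w hq => ?_ <;> simp
  | ck1_same e =>
    simp only [map_mul, LeavittFree.lift_of]
    refine LinearMap.ext fun Φ => harmonic_ext ?_ fun p q w hq => ?_ <;> simp
  | ck1_ne e f h =>
    simp only [map_mul, map_zero, LeavittFree.lift_of]
    refine LinearMap.ext fun Φ => harmonic_ext ?_ fun p q w hq => ?_ <;> simp [h]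
  | ck2 v F hF hne =>
    simp only [map_mul, map_sum, LeavittFree.lift_of]
    have hv : G.IsRegular v := ⟨F.finite_toSet.subset fun e he => (hF e).2 he,
      hne.imp fun e he => (hF e).1 he⟩
    obtain rfl : F = hv.1.toFinset := by ext e; simp [hF]
    refine LinearMap.ext fun Φ => harmonic_ext ?_ fun p q w hq => ?_
    · simp only [LinearMap.sum_apply, Submodule.coe_sum, Prod.fst_sum, Module.End.mul_apply,
        act_vtx_one, act_edge_one, act_ghost]
      exact Φ.2.2 v hv [] []
    · simp only [LinearMap.sum_apply, Submodule.coe_sum, Prod.snd_sum, Finset.sum_apply,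
        Module.End.mul_apply]
      rcases q with _ | ⟨f, q⟩
      · simp only [act_vtx_nil, act_edge_nil, act_ghost]
        split_ifs with h
        · subst h
          rw [Φ.2.2 w hv p []]
          refine Finset.sum_congr rfl fun e he => ?_
          rw [if_pos ((hF e).1 he), List.nil_append]
        · refine (Finset.sum_eq_zero fun e he => if_neg fun h' => h ?_).symm
          rw [← h', (hF e).1 he]
      · simp only [act_vtx_cons, act_edge_cons, act_ghost]
        split_ifs with h
        · rw [Finset.sum_eq_single_of_mem f ((hF f).2 h)]
          · rw [if_pos ⟨rfl, (isWalkTo_cons.1 hq).1⟩]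
          · intro e _ hef
            exact if_neg fun h' => hef h'.1.symm
        · refine (Finset.sum_eq_zero fun e he => if_neg fun h' => h ?_).symm
          rw [h'.1, (hF e).1 he]

variable (K G M)

/-- The Leavitt path algebra acts on harmonic functions by right translation. -/
noncomputable def action : LeavittPathAlgebra K G →ₙₐ[K] Module.End K (harmonic K G M) :=
  lift (B := Module.End K (harmonic K G M)) (LeavittFree.lift (act K G M)) lift_act_rel

variable {K G M}

theorem action_vtx (v : V) : action K G M (vtx K G v) = act K G M (.vtx v) :=
  LeavittFree.lift_of (act K G M) _

theorem action_edge (e : A) : action K G M (edge K G e) = act K G M (.edge e) :=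
  LeavittFree.lift_of (act K G M) _

theorem action_ghost (e : A) : action K G M (ghost K G e) = act K G M (.ghost e) :=
  LeavittFree.lift_of (act K G M) _

/-- Translation by a product a b applies b first and then a, so (x · Φ)(z) = Φ(z x). The prefix `p₀`
is left free because it grows by one edge at each step of the induction. -/
theorem action_ofWalk_apply {u w : V} (p₀ : List A) {p : List A} (hp : G.IsWalk u p w)
    (Φ : harmonic K G M) :
    (action K G M (ofWalk K G w p) Φ).1.2 p₀ [] u = Φ.1.2 (p₀ ++ p) [] w := by
  induction p generalizing u p₀ with
  | nil =>
    obtain rfl : u = w := hp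
    simp [ofWalk_nil, action_vtx]
  | cons e p ih =>
    obtain ⟨rfl, hp⟩ := hp
    simp [ofWalk_cons, action_edge, ih _ hp]

theorem action_ofWalk_one {u w : V} {p : List A} (hp : G.IsWalk u p w) (Φ : harmonic K G M) :
    (action K G M (ofWalk K G w p) Φ).1.1 = Φ.1.2 p [] w := by
  cases p with
  | nil => simp [ofWalk_nil, action_vtx]
  | cons e p => simp [ofWalk_cons, action_edge, action_ofWalk_apply _ hp.2]

theorem action_star_ofWalk_apply (w : V) (p q : List A) (Φ : harmonic K G M) :
    (action K G M (star (ofWalk K G w q)) Φ).1.2 p [] w = Φ.1.2 p q w := by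
  induction q generalizing Φ with
  | nil => simp [star_ofWalk_nil, action_vtx]
  | cons e q ih => simp [star_ofWalk_cons, action_ghost, ih]

end Harmonic

variable {G}

/-- A function of the paths `p` and `q` which respects the relation `p q* = ∑ e, (p e) (q e)*`
is given by a linear map. -/
theorem exists_linearMap {M : Type*} [AddCommGroup M] [Module K M] (F : List A → List A → V → M)
    (hF : ∀ w (hw : G.IsRegular w) p q, G.IsWalkTo p w → G.IsWalkTo q w →
      F p q w = ∑ e ∈ hw.1.toFinset, F (p ++ [e]) (q ++ [e]) (G.range e)) :
    ∃ T : LeavittPathAlgebra K G →ₗ[K] M, ∀ w p q, G.IsWalkTo p w → G.IsWalkTo q w →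
      T (mono K G w p q) = F p q w := by
  classical
  let Φ : harmonic K G M :=
    ⟨(0, fun p q w => if G.IsWalkTo p w ∧ G.IsWalkTo q w then F p q w else 0),
      fun p q w h => if_neg fun h' => h h'.2, fun w hw p q => by
        -- Setting F to zero off paths keeps it harmonic: for e emitted by w, the list p e is a path
        -- to r(e) exactly when p is a path to w.
        have h : ∀ e ∈ hw.1.toFinset, (G.IsWalkTo (p ++ [e]) (G.range e) ∧
            G.IsWalkTo (q ++ [e]) (G.range e) ↔ G.IsWalkTo p w ∧ G.IsWalkTo q w) := by
          intro e he
          obtain rfl : G.source e = w := by simpa using he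
          rw [DirectedGraph.isWalkTo_concat, DirectedGraph.isWalkTo_concat]
        change (if G.IsWalkTo p w ∧ G.IsWalkTo q w then F p q w else 0) =
          ∑ e ∈ hw.1.toFinset, if G.IsWalkTo (p ++ [e]) (G.range e) ∧
            G.IsWalkTo (q ++ [e]) (G.range e) then F (p ++ [e]) (q ++ [e]) (G.range e) else 0
        rw [Finset.sum_congr rfl fun e he => if_congr (h e he) rfl rfl]
        split_ifs with hpq
        · exact hF w hw p q hpq.1 hpq.2
        · simp⟩
  -- The map is x ↦ (x · Φ)(1). The value 0 given to Φ itself at the unit plays no role, as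
  -- translates never read it.
  refine ⟨{ toFun := fun x => (action K G M x Φ).1.1
            map_add' := fun x y => by simp
            map_smul' := fun k x => by simp }, fun w p q hp hq => ?_⟩
  change (action K G M (mono K G w p q) Φ).1.1 = _
  rw [mono, map_mul, Module.End.mul_apply, action_ofWalk_one hp, action_star_ofWalk_apply]
  exact if_pos ⟨hp, hq⟩
end LeavittPathAlgebra

/-! ### Traces -/

namespace DirectedGraph

variable {V A : Type*} {G : DirectedGraph V A}

theorem IsWalk.end_unique {u w w' : V} {p : List A} (h : G.IsWalk u p w) (h' : G.IsWalk u p w') :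
    w = w' := by
  induction p generalizing u with
  | nil => exact h.symm.trans h'
  | cons e p ih => exact ih h.2 h'.2

theorem isWalk_of_append {w : V} {p u : List A} (hp : G.IsWalkTo p w)
    (hpu : G.IsWalkTo (p ++ u) w) (hs : G.startOf w (p ++ u) = G.startOf w p) :
    G.IsWalk w u w := by
  rw [IsWalkTo, hs] at hpu
  obtain ⟨x, hx, hu⟩ := isWalk_append.1 hpu
  rwa [← hp.end_unique hx] at hu

end DirectedGraph

namespace LeavittPathAlgebra

variable {K V A : Type*} [Field K] {G : DirectedGraph V A}

theorem mono_mul_edge_nil (e : A) (p : List A) :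
    mono K G (G.source e) p [] * edge K G e = mono K G (G.range e) (p ++ [e]) [] := by
  rw [mono, mono, star_ofWalk_nil, star_ofWalk_nil, ofWalk_mul_vtx, ofWalk_mul_vtx, ofWalk_concat]

theorem mono_mul_edge_nil_of_ne {e : A} {w : V} (h : w ≠ G.source e) (p : List A) :
    mono K G w p [] * edge K G e = 0 := by
  rw [mono, star_ofWalk_nil, ← vtx_mul_edge, mul_assoc, ← mul_assoc (vtx K G w),
    vtx_mul_vtx_of_ne h, zero_mul, mul_zero]

theorem ghost_mul_mono_nil (e : A) (q : List A) :
    ghost K G e * mono K G (G.source e) [] q = mono K G (G.range e) [] (q ++ [e]) := by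
  rw [← star_edge, ← star_mono, ← star_mul, mono_mul_edge_nil, star_mono]

theorem ghost_mul_mono_nil_of_ne {e : A} {w : V} (h : w ≠ G.source e) (q : List A) :
    ghost K G e * mono K G w [] q = 0 := by
  rw [← star_edge, ← star_mono, ← star_mul, mono_mul_edge_nil_of_ne h, star_zero]

section Trace

variable {M : Type*} [AddCommGroup M] [Module K M] (φ : V → List A → M)

open Classical in
variable (G) in
/-- The value at `p q*` of the trace with values `φ` on closed paths. -/
noncomputable def traceFun (p q : List A) (w : V) : M :=
  if q <+: p ∧ G.startOf w p = G.startOf w q then φ w (p.drop q.length) else 0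

variable {φ}

theorem traceFun_append {w : V} {q u : List A} (h : G.startOf w (q ++ u) = G.startOf w q) :
    traceFun G φ (q ++ u) q w = φ w u := by
  rw [traceFun, if_pos ⟨List.prefix_append q u, h⟩, List.drop_left]

theorem traceFun_of_not {w : V} {p q : List A}
    (h : ¬ (q <+: p ∧ G.startOf w p = G.startOf w q)) : traceFun G φ p q w = 0 :=
  if_neg h

theorem traceFun_cons {w : V} {p q : List A} (e : A) (h : G.startOf w p = G.startOf w q) :
    traceFun G φ (e :: p) (e :: q) w = traceFun G φ p q w := by
  unfold traceFun
  congr 1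
  simp [h]

variable (hv : ∀ w (hw : G.IsRegular w), φ w [] = ∑ e ∈ hw.1.toFinset, φ (G.range e) [])
  (hφ : ∀ w f u, G.IsWalk w (f :: u) w → φ w (f :: u) = φ (G.range f) (u ++ [f]))

include hv hφ

-- If p = q, additivity on vertices is what is required. If p = q u with u = f ⋯ of positive length,
-- the sum has a single nonzero term, at e = f, and that term is the rotated path.
open DirectedGraph in
theorem traceFun_eq_sum {w : V} (hw : G.IsRegular w) {p q : List A} (hp : G.IsWalkTo p w)
    (hq : G.IsWalkTo q w) : traceFun G φ p q w =
      ∑ e ∈ hw.1.toFinset, traceFun G φ (p ++ [e]) (q ++ [e]) (G.range e) := by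
  have src : ∀ {e : A}, e ∈ hw.1.toFinset → G.source e = w := fun he => by simpa using he
  by_cases h : q <+: p ∧ G.startOf w p = G.startOf w q
  · obtain ⟨⟨u, rfl⟩, hs⟩ := h
    have hu := isWalk_of_append hq hp hs
    rw [traceFun_append hs]
    cases u with
    | nil =>
      rw [hv w hw]
      refine Finset.sum_congr rfl fun e _ => ?_
      have := traceFun_append (G := G) (φ := φ) (w := G.range e) (q := q ++ [e]) (u := [])
        (by rw [List.append_nil])
      rw [← this, List.append_nil, List.append_nil]
    | cons f u =>
      rw [hφ w f u hu, Finset.sum_eq_single_of_mem f (by simpa using hu.1)]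
      · rw [← traceFun_append (G := G) (φ := φ) (q := q ++ [f])]
        · simp
        · have : q ++ [f] ++ (u ++ [f]) = (q ++ f :: u) ++ [f] := by simp
          rw [this, startOf_concat, startOf_concat, hu.1, hs]
      · intro e _ hef
        refine traceFun_of_not fun h => hef ?_
        have h := h.1
        rw [List.append_assoc, List.prefix_append_right_inj, List.cons_append,
          List.cons_prefix_cons] at h
        exact h.1
  · rw [traceFun_of_not h, Finset.sum_eq_zero]
    -- If q e is an initial segment of p e, comparing lengths makes q an initial segment of p, so no
    -- term survives.
    intro e he
    refine traceFun_of_not fun h' => h ⟨?_, ?_⟩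
    · have hl := h'.1.length_le
      simp only [List.length_append, List.length_singleton, add_le_add_iff_right] at hl
      exact List.prefix_of_prefix_length_le ((List.prefix_append q [e]).trans h'.1)
        (List.prefix_append p [e]) hl
    · have := h'.2
      rwa [startOf_concat, startOf_concat, src he] at this

-- For an edge or ghost edge, multiplying on one side prepends it to p or q, and on the other side
-- it cancels a first edge or is appended. Prepending a common edge does not change the trace, and
-- appending amounts to a rotation.
omit hv in
open DirectedGraph in
theorem trace_generator_mul {T : LeavittPathAlgebra K G →ₗ[K] M}
    (hT : ∀ w p q, G.IsWalkTo p w → G.IsWalkTo q w → T (mono K G w p q) = traceFun G φ p q w)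
    (g : LeavittGen V A) (w : V) (p q : List A) (hp : G.IsWalkTo p w) (hq : G.IsWalkTo q w) :
    T (mk K G (LeavittFree.of K g) * mono K G w p q) =
      T (mono K G w p q * mk K G (LeavittFree.of K g)) := by
  classical
  rcases g with v | e | e
  · change T (vtx K G v * _) = T (_ * vtx K G v)
    have h₁ : T (vtx K G v * mono K G w p q) =
        if v = G.startOf w p then traceFun G φ p q w else 0 := by
      rw [mono, ← mul_assoc]
      split_ifs with h
      · rw [h, vtx_mul_ofWalk_self, ← hT w p q hp hq, mono]
      · rw [vtx_mul_ofWalk_of_ne h, zero_mul, map_zero]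
    have h₂ : T (mono K G w p q * vtx K G v) =
        if v = G.startOf w q then traceFun G φ p q w else 0 := by
      rw [mono, mul_assoc]
      split_ifs with h
      · rw [h, star_ofWalk_mul_vtx_self, ← hT w p q hp hq, mono]
      · rw [star_ofWalk_mul_vtx_of_ne h, mul_zero, map_zero]
    rw [h₁, h₂]
    by_cases h : G.startOf w p = G.startOf w q
    · rw [h]
    · rw [traceFun_of_not fun h' => h h'.2]
      simp
  · change T (edge K G e * _) = T (_ * edge K G e)
    have h₁ : T (edge K G e * mono K G w p q) =
        if G.range e = G.startOf w p then traceFun G φ (e :: p) q w else 0 := by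
      rw [mono, ← mul_assoc, ← ofWalk_cons]
      split_ifs with h
      · rw [← hT w (e :: p) q (isWalkTo_cons.2 ⟨h.symm, hp⟩) hq, mono]
      · rw [ofWalk_cons, edge_mul_ofWalk_of_ne h, zero_mul, map_zero]
    rw [h₁]
    cases q with
    | nil =>
      by_cases hw : w = G.source e
      · subst hw
        rw [mono_mul_edge_nil, hT _ _ _ (isWalkTo_concat.2 hp) (isWalkTo_nil _)]
        split_ifs with h
        -- Here e p is closed and the two sides are φ at e p and at its rotation p e; this is where
        -- rotation invariance is used.
        · have h₃ : G.IsWalk (G.source e) (e :: p) (G.source e) := ⟨rfl, by rw [h]; exact hp⟩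
          have h₄ := traceFun_append (G := G) (φ := φ) (w := G.source e) (q := []) (u := e :: p) rfl
          have h₅ := traceFun_append (G := G) (φ := φ) (w := G.range e) (q := []) (u := p ++ [e])
            (by rw [List.nil_append, startOf_concat, ← h, startOf_nil])
          rw [List.nil_append] at h₄ h₅
          rw [h₄, h₅, hφ _ _ _ h₃]
        · refine (traceFun_of_not fun h' => h ?_).symm
          have hs := h'.2
          rw [startOf_concat] at hs
          exact hs.symm
      · rw [mono_mul_edge_nil_of_ne hw, map_zero, ite_eq_right_iff]
        exact fun _ => traceFun_of_not fun h' => hw h'.2.symm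
    | cons f q =>
      by_cases hef : e = f
      · subst hef
        obtain ⟨hs, hq⟩ := isWalkTo_cons.1 hq
        rw [mono, mul_assoc, star_ofWalk_mul_edge hs, ← mono, hT w p q hp hq]
        split_ifs with h
        · exact traceFun_cons e (h.symm.trans hs.symm)
        · exact (traceFun_of_not fun h' => h (hs.symm.trans h'.2.symm)).symm
      · rw [mono, mul_assoc, star_ofWalk_mul_edge_of_ne hef, mul_zero, map_zero, ite_eq_right_iff]
        exact fun _ => traceFun_of_not fun h' => hef (List.cons_prefix_cons.1 h'.1).1.symm
  · change T (ghost K G e * _) = T (_ * ghost K G e)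
    have h₁ : T (mono K G w p q * ghost K G e) =
        if G.range e = G.startOf w q then traceFun G φ p (e :: q) w else 0 := by
      rw [mono, mul_assoc, ← star_ofWalk_cons]
      split_ifs with h
      · rw [← hT w p (e :: q) hp (isWalkTo_cons.2 ⟨h.symm, hq⟩), mono]
      · rw [star_ofWalk_cons, star_ofWalk_mul_ghost_of_ne h, mul_zero, map_zero]
    rw [h₁]
    cases p with
    | nil =>
      have h₀ : traceFun G φ [] (e :: q) w = 0 := traceFun_of_not fun h => by simpa using h.1
      rw [h₀, ite_self]
      by_cases hw : w = G.source e
      · subst hw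
        rw [ghost_mul_mono_nil, hT _ _ _ (isWalkTo_nil _) (isWalkTo_concat.2 hq)]
        exact traceFun_of_not fun h => by simpa using h.1
      · rw [ghost_mul_mono_nil_of_ne hw, map_zero]
    | cons f p =>
      by_cases hef : e = f
      · subst hef
        obtain ⟨hs, hp⟩ := isWalkTo_cons.1 hp
        rw [mono, ← mul_assoc, ghost_mul_ofWalk_cons hs, ← mono, hT w p q hp hq]
        split_ifs with h
        · exact (traceFun_cons e (hs.trans h)).symm
        · exact traceFun_of_not fun h' => h (hs.symm.trans h'.2)
      · rw [mono, ← mul_assoc, ghost_mul_ofWalk_cons_of_ne hef, zero_mul, map_zero, eq_comm,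
          ite_eq_right_iff]
        exact fun _ => traceFun_of_not fun h' => hef (List.cons_prefix_cons.1 h'.1).1

/-- A function of closed paths which is invariant under rotation and respects the relations
`w = ∑ e, r(e)` at regular vertices extends to a linear map which vanishes on commutators. -/
theorem exists_trace : ∃ T : LeavittPathAlgebra K G →ₗ[K] M,
    (∀ x ∈ commutators K G, T x = 0) ∧
    ∀ w p q, G.IsWalkTo p w → G.IsWalkTo q w → T (mono K G w p q) = traceFun G φ p q w := by
  obtain ⟨T, hT⟩ := exists_linearMap (K := K) (traceFun G φ)
    fun w hw p q hp hq => traceFun_eq_sum hv hφ hw hp hq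
  refine ⟨T, ?_, hT⟩
  have gen : ∀ g a, T (mk K G (LeavittFree.of K g) * a) = T (a * mk K G (LeavittFree.of K g)) := by
    intro g a
    have : T ∘ₗ LinearMap.mulLeft K (mk K G (LeavittFree.of K g)) =
        T ∘ₗ LinearMap.mulRight K (mk K G (LeavittFree.of K g)) :=
      linearMap_ext fun w p q hp hq => trace_generator_mul hφ hT g w p q hp hq
    exact LinearMap.congr_fun this a
  -- The b with T(b a) = T(a b) for all a form a subalgebra, so generators suffice.
  have comm : ∀ b a, T (b * a) = T (a * b) := by
    intro b
    induction b using induction_on with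
    | vtx v => exact gen (.vtx v)
    | edge e => exact gen (.edge e)
    | ghost e => exact gen (.ghost e)
    | zero => simp
    | add x y hx hy => intro a; rw [add_mul, mul_add, map_add, map_add, hx, hy]
    | smul k x hx => intro a; rw [smul_mul_assoc, mul_smul_comm, map_smul, map_smul, hx]
    | mul x y hx hy => intro a; rw [mul_assoc, hx, mul_assoc, hy, mul_assoc]
  intro x hx
  have hle : commutators K G ≤ LinearMap.ker T := by
    refine Submodule.span_le.2 ?_
    rintro _ ⟨a, b, rfl⟩
    rw [SetLike.mem_coe, LinearMap.mem_ker, map_sub, comm, sub_self]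
  exact hle hx

end Trace

end LeavittPathAlgebra

/-! ### Closed paths and rotations -/

namespace DirectedGraph

variable {V A : Type*} {G : DirectedGraph V A}

theorem Path.exists_isConcat {p q : G.Path} (ht : q.tgt = p.tgt) (hs : q.src = p.src)
    (h : q.edges <+: p.edges) :
    ∃ u : G.Path, p.IsConcat q u ∧ u.IsClosed := by
  obtain ⟨u, hu⟩ := h
  have hw : G.IsWalk q.tgt u q.tgt := by
    refine isWalk_of_append (p := q.edges) q.isWalkTo ?_ ?_
    · rw [hu, ht]
      exact p.isWalkTo
    · rw [hu, q.startOf_edges, hs, ht, p.startOf_edges]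
  exact ⟨⟨q.tgt, q.tgt, u, hw⟩, ⟨hs.symm, rfl, ht.symm, hu.symm⟩, rfl⟩

theorem IsWalk.unique {u u' w w' : V} {p : List A} (hp : p ≠ []) (h : G.IsWalk u p w)
    (h' : G.IsWalk u' p w') : u = u' ∧ w = w' := by
  cases p with
  | nil => exact absurd rfl hp
  | cons e p => exact ⟨h.1.symm.trans h'.1, h.2.end_unique h'.2⟩

/-- A nonempty list of edges determines both endpoints of a path, so rotating the list loses
nothing. For vertices this fails: all of them have the empty list. -/
theorem Path.rotates_iff {p q : G.Path} (hp : p.IsNontrivialClosed) (hq : q.IsNontrivialClosed) :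
    p.Rotates q ↔ p.edges ~r q.edges := by
  constructor
  · rintro ⟨x, y, ⟨-, -, -, h₁⟩, ⟨-, -, -, h₂⟩⟩
    rw [h₁, h₂]
    exact List.isRotated_append
  · intro h
    obtain ⟨n, hn, h⟩ := List.isRotated_iff_mod.1 h
    rw [List.rotate_eq_drop_append_take hn] at h
    have hw := p.isWalk
    rw [← List.take_append_drop n p.edges] at hw
    obtain ⟨z, hx, hy⟩ := isWalk_append.1 hw
    have hy' : G.IsWalk z (p.edges.drop n) p.src := by
      rw [hp.1]
      exact hy
    have hz : G.IsWalk z q.edges z := by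
      rw [← h]
      exact isWalk_append.2 ⟨_, hy', hx⟩
    obtain ⟨h₁, h₂⟩ := q.isWalk.unique hq.2 hz
    exact ⟨⟨_, _, _, hx⟩, ⟨_, _, _, hy'⟩, ⟨rfl, rfl, hp.1.symm, (List.take_append_drop n _).symm⟩,
      ⟨h₁, rfl, h₂, h.symm⟩⟩

variable (K : Type*) [Field K]

theorem mapRange_B {v : V} (hv : G.IsRegular v) :
    (G.B v).mapRange (Int.cast : ℤ → K) Int.cast_zero =
      (∑ e ∈ hv.1.toFinset, Finsupp.single (G.range e) 1) - Finsupp.single v 1 := by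
  classical
  change Finsupp.mapRange.addMonoidHom (Int.castAddHom K) (G.B v) = _
  rw [B, dif_pos hv, map_sub, map_sum]
  simp

theorem mapRange_B_of_not {v : V} (hv : ¬ G.IsRegular v) :
    (G.B v).mapRange (Int.cast : ℤ → K) Int.cast_zero = 0 := by
  rw [B, dif_neg hv, Finsupp.mapRange_zero]

end DirectedGraph

namespace LeavittPathAlgebra

variable {K V A : Type*} [Field K] {G : DirectedGraph V A}

open DirectedGraph

theorem ofPath_isConcat {p a b : G.Path} (h : p.IsConcat a b) :
    ofPath K p = ofPath K a * ofPath K b := by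
  rw [ofPath, h.2.2.2, h.2.2.1, ofWalk_append (x := a.tgt), ofPath, ofPath]
  rw [b.startOf_edges, h.2.1]

theorem ofPath_mul_vtx (p : G.Path) : ofPath K p * vtx K G p.tgt = ofPath K p :=
  ofWalk_mul_vtx _ _

theorem star_ofPath_mul_vtx (p : G.Path) :
    star (ofPath K p) * vtx K G p.src = star (ofPath K p) := by
  rw [← p.startOf_edges]
  exact star_ofWalk_mul_vtx_self _ _

theorem star_ofPath_mul_ofPath (p : G.Path) :
    star (ofPath K p) * ofPath K p = vtx K G p.tgt :=
  star_ofWalk_mul_ofWalk _ p.isWalkTo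

theorem ofPath_mul_star_ofPath {p q : G.Path} (h : p.tgt = q.tgt) :
    ofPath K p * star (ofPath K q) = mono K G q.tgt p.edges q.edges := by
  rw [mono, ← h, ofPath, ofPath, h]

variable (K G) in
/-- The involution as a linear map. -/
noncomputable def starₗ : LeavittPathAlgebra K G →ₗ[K] LeavittPathAlgebra K G where
  toFun := star
  map_add' := star_add
  map_smul' := star_smul_eq

theorem starₗ_apply (x : LeavittPathAlgebra K G) : starₗ K G x = star x := rfl

/-! ### Skew-symmetric elements as spans -/

/-- Paths with a common end which do not differ by a closed path. -/
def IsTransverse (t q : G.Path) : Prop :=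
  t.tgt = q.tgt ∧ (∀ u : G.Path, u.IsClosed → ¬ q.IsConcat t u) ∧
    ∀ u : G.Path, u.IsClosed → ¬ t.IsConcat q u

theorem IsTransverse.symm {t q : G.Path} (h : IsTransverse t q) : IsTransverse q t :=
  ⟨h.1.symm, h.2.2, h.2.1⟩

theorem IsTransverse.not_prefix {t q : G.Path} (h : IsTransverse t q) :
    ¬ (t.edges <+: q.edges ∧ t.src = q.src) := by
  rintro ⟨h₁, h₂⟩
  obtain ⟨u, hu, hc⟩ := Path.exists_isConcat h.1 h₂ h₁
  exact h.2.1 u hc hu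

theorem IsTransverse.star_mul_eq_zero {t q : G.Path} (h : IsTransverse t q) :
    star (ofPath K t) * ofPath K q = 0 := by
  refine star_ofWalk_mul_ofWalk_eq_zero t.isWalkTo q.isWalkTo ?_ ?_ <;>
    rw [t.startOf_edges, q.startOf_edges]
  · exact h.not_prefix
  · rw [eq_comm (a := t.src)]
    exact h.symm.not_prefix

variable (K) in
/-- The element `t q* - q t*`. -/
noncomputable def skewPair (t q : G.Path) : LeavittPathAlgebra K G :=
  ofPath K t * star (ofPath K q) - ofPath K q * star (ofPath K t)

variable (K) in
/-- The element `x y* x* - x y x*`. -/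
noncomputable def skewLoop (x y : G.Path) : LeavittPathAlgebra K G :=
  ofPath K x * star (ofPath K y) * star (ofPath K x) - ofPath K x * ofPath K y * star (ofPath K x)

theorem star_skewPair (t q : G.Path) : star (skewPair K t q) = - skewPair K t q := by
  simp [skewPair]

theorem star_skewLoop (x y : G.Path) : star (skewLoop K x y) = - skewLoop K x y := by
  simp [skewLoop, mul_assoc]

variable (K G) in
/-- The set of elements `t q* - q t*` where `t` and `q` do not differ by a closed path. -/
def skewPairs : Set (LeavittPathAlgebra K G) :=
  {z | ∃ t q : G.Path, IsTransverse t q ∧ z = skewPair K t q}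

variable (K G) in
/-- The set of elements `x y* x* - x y x*` where `y` is a closed path of positive length. -/
def skewLoops : Set (LeavittPathAlgebra K G) :=
  {z | ∃ x y : G.Path, x.tgt = y.src ∧ y.IsNontrivialClosed ∧ z = skewLoop K x y}

variable (K G) in
/-- The span of the elements which occur in skew forms. -/
noncomputable def skewSpan : Submodule K (LeavittPathAlgebra K G) :=
  Submodule.span K (skewPairs K G) ⊔ Submodule.span K (skewLoops K G)

theorem skewPair_of_isConcat {t q u : G.Path} (h : q.IsConcat t u) :
    skewPair K t q = skewLoop K t u := by
  rw [skewPair, skewLoop, ofPath_isConcat h, star_mul, mul_assoc, mul_assoc]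

theorem skewPair_swap (t q : G.Path) : skewPair K q t = - skewPair K t q := by
  rw [skewPair, skewPair, neg_sub]

theorem skewPair_mem_of_isConcat {t q u : G.Path} (h : q.IsConcat t u) (hu : u.IsClosed) :
    skewPair K t q ∈ skewSpan K G := by
  by_cases he : u.edges = []
  · have hq : q = t := by
      refine Path.ext_of_edges ?_ ?_
      · rw [h.2.2.1, h.2.1, hu]
      · rw [h.2.2.2, he, List.append_nil]
    rw [hq, skewPair, sub_self]
    exact zero_mem _
  · rw [skewPair_of_isConcat h]
    exact Submodule.mem_sup_right (Submodule.subset_span ⟨t, u, h.2.1, ⟨hu, he⟩, rfl⟩)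

theorem skewPair_mem {t q : G.Path} (h : t.tgt = q.tgt) : skewPair K t q ∈ skewSpan K G := by
  by_cases h₁ : ∃ u : G.Path, u.IsClosed ∧ q.IsConcat t u
  · obtain ⟨u, hu, hc⟩ := h₁
    exact skewPair_mem_of_isConcat hc hu
  by_cases h₂ : ∃ u : G.Path, u.IsClosed ∧ t.IsConcat q u
  · obtain ⟨u, hu, hc⟩ := h₂
    rw [skewPair_swap]
    exact neg_mem (skewPair_mem_of_isConcat hc hu)
  · push Not at h₁ h₂
    exact Submodule.mem_sup_left (Submodule.subset_span ⟨t, q, ⟨h, h₁, h₂⟩, rfl⟩)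

/-- By linearity it suffices to take a = p q*, and then a - a* is a `skewPair`. -/
theorem sub_star_mem (a : LeavittPathAlgebra K G) : a - star a ∈ skewSpan K G := by
  have h : Submodule.span K (monos K G) ≤ (skewSpan K G).comap (LinearMap.id - starₗ K G) := by
    refine Submodule.span_le.2 ?_
    rintro _ ⟨w, p, q, hp, hq, rfl⟩
    change mono K G w p q - star (mono K G w p q) ∈ skewSpan K G
    rw [star_mono]
    exact skewPair_mem (t := hp.toPath) (q := hq.toPath) rfl
  rw [span_monos] at h
  exact h (Submodule.mem_top (x := a))

theorem mem_skewSpan_of_star_eq_neg (h2 : (2 : K) ≠ 0) {x : LeavittPathAlgebra K G}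
    (hx : star x = -x) : x ∈ skewSpan K G := by
  have h : (2 : K)⁻¹ • (x - star x) = x := by
    rw [hx, sub_neg_eq_add, ← two_smul K x, smul_smul, inv_mul_cancel₀ h2, one_smul]
  rw [← h]
  exact Submodule.smul_mem _ _ (sub_star_mem x)

/-! ### Symmetric elements -/

theorem mono_eq_sum {w : V} (hw : G.IsRegular w) (p q : List A) :
    mono K G w p q = ∑ e ∈ hw.1.toFinset, mono K G (G.range e) (p ++ [e]) (q ++ [e]) := by
  rw [mono, ← ofWalk_mul_vtx, vtx_eq_sum hw, Finset.mul_sum, Finset.sum_mul]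
  refine Finset.sum_congr rfl fun e he => ?_
  obtain rfl : G.source e = w := by simpa using he
  rw [mono, ofWalk_concat, ofWalk_concat, star_mul, star_edge, mul_assoc, mul_assoc, mul_assoc]

open Classical in
variable (K G) in
/-- A property of pairs of paths which does not change when both are continued by the same edge
singles out a linear endomorphism of the algebra. -/
theorem exists_restrict (P : List A → List A → Prop)
    (hP : ∀ e p q, P (p ++ [e]) (q ++ [e]) ↔ P p q) :
    ∃ T : LeavittPathAlgebra K G →ₗ[K] LeavittPathAlgebra K G,
      ∀ w p q, G.IsWalkTo p w → G.IsWalkTo q w →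
        T (mono K G w p q) = if P p q then mono K G w p q else 0 := by
  refine exists_linearMap (fun p q w => if P p q then mono K G w p q else 0)
    fun w hw p q _ _ => ?_
  simp only [hP]
  split_ifs
  · exact mono_eq_sum hw p q
  · simp

variable (K G) in
/-- The span of the elements `p p*`. -/
noncomputable def diagSpan : Submodule K (LeavittPathAlgebra K G) :=
  Submodule.span K (Set.range fun p : G.Path => ofPath K p * star (ofPath K p))

/-- Every element which is fixed by the involution is the sum of a combination of elements `p p*`
and an element of the form `y + y*`. -/
theorem exists_eq_diag_add {x : LeavittPathAlgebra K G} (hx : star x = x) :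
    ∃ d ∈ diagSpan K G, ∃ y, x = d + (y + star y) := by
  classical
  -- Any linear order on the edges will do. Lists are compared lexicographically after reversal, so
  -- that continuing both by the same edge prepends a common letter and preserves the comparison;
  -- this makes the part with p before q well defined.
  let _ : LinearOrder A := IsWellOrder.linearOrder WellOrderingRel
  obtain ⟨D, hD⟩ := exists_restrict K G (fun p q => p = q) (by simp)
  obtain ⟨R, hR⟩ := exists_restrict K G (fun p q => p.reverse < q.reverse)
    (by simp)
  have hDmem : D x ∈ diagSpan K G := by
    have h : Submodule.span K (monos K G) ≤ (diagSpan K G).comap D := by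
      refine Submodule.span_le.2 ?_
      rintro _ ⟨w, p, q, hp, hq, rfl⟩
      rw [SetLike.mem_coe, Submodule.mem_comap, hD w p q hp hq]
      split_ifs with h
      · subst h
        exact Submodule.subset_span ⟨hp.toPath, rfl⟩
      · exact zero_mem _
    rw [span_monos] at h
    exact h (Submodule.mem_top (x := x))
  -- The three summands keep the terms p q* with p = q, with p before q, and with p after q.
  have hsum : LinearMap.id = D + (R + starₗ K G ∘ₗ R ∘ₗ starₗ K G) := by
    refine linearMap_ext fun w p q hp hq => ?_
    simp only [LinearMap.id_apply, LinearMap.add_apply, LinearMap.comp_apply, starₗ_apply,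
      star_mono, hD w p q hp hq, hR w p q hp hq, hR w q p hq hp]
    rcases lt_trichotomy p.reverse q.reverse with h | h | h
    · have hne : p ≠ q := fun h' => by simp [h'] at h
      simp [h, hne, h.not_gt]
    · have heq : p = q := List.reverse_injective h
      simp [heq]
    · have hne : p ≠ q := fun h' => by simp [h'] at h
      simp [h, hne, h.not_gt, star_mono]
  refine ⟨D x, hDmem, R x, ?_⟩
  have := LinearMap.congr_fun hsum x
  simpa only [LinearMap.id_apply, LinearMap.add_apply, LinearMap.comp_apply, starₗ_apply, hx]
    using this

theorem neg_eq_self_of_two_eq_zero (h2 : (2 : K) = 0) (x : LeavittPathAlgebra K G) : -x = x := by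
  rw [neg_eq_iff_add_eq_zero, ← two_smul K x, h2, zero_smul]

theorem mem_diagSpan_sup_skewSpan (h2 : (2 : K) = 0) {x : LeavittPathAlgebra K G}
    (hx : star x = -x) : ∃ d ∈ diagSpan K G, ∃ z ∈ skewSpan K G, x = d + z := by
  rw [neg_eq_self_of_two_eq_zero h2] at hx
  obtain ⟨d, hd, y, h⟩ := exists_eq_diag_add hx
  refine ⟨d, hd, y - star y, sub_star_mem y, ?_⟩
  rw [sub_eq_add_neg, neg_eq_self_of_two_eq_zero h2, h]

/-! ### Skew forms -/

theorem value_eq (D : SkewForm K G) :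
    D.value = (∑ i, D.b i • skewPair K (D.t i) (D.q i)) +
      ∑ i, ∑ j, D.c i j • skewLoop K (D.x i j) (D.y i j) := rfl

theorem star_value (D : SkewForm K G) : star D.value = - D.value := by
  rw [value_eq, ← starₗ_apply, map_add, map_sum, map_sum, neg_add, ← Finset.sum_neg_distrib,
    ← Finset.sum_neg_distrib]
  congr 1
  · refine Finset.sum_congr rfl fun i _ => ?_
    rw [map_smul, starₗ_apply, star_skewPair, smul_neg]
  · refine Finset.sum_congr rfl fun i _ => ?_
    rw [map_sum, ← Finset.sum_neg_distrib]
    refine Finset.sum_congr rfl fun j _ => ?_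
    rw [map_smul, starₗ_apply, star_skewLoop, smul_neg]

/-- Loops can be sorted by their rotation classes. -/
theorem exists_skewForm {l n : ℕ} (b : Fin l → K) (t q : Fin l → G.Path)
    (htq : ∀ i, IsTransverse (t i) (q i)) (c : Fin n → K) (x y : Fin n → G.Path)
    (hxy : ∀ i, (x i).tgt = (y i).src) (hy : ∀ i, (y i).IsNontrivialClosed) :
    ∃ D : SkewForm K G, D.value =
      (∑ i, b i • skewPair K (t i) (q i)) + ∑ i, c i • skewLoop K (x i) (y i) := by
  classical
  -- The rows of the form are the classes of this relation, so each row is nonempty and `y_rotates`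
  -- becomes equality of classes.
  let s : Setoid (Fin n) :=
    { r := fun i j => (y i).edges ~r (y j).edges
      iseqv := ⟨fun _ => .refl _, fun h => h.symm, fun h h' => h.trans h'⟩ }
  let e : Quotient s ≃ Fin (Fintype.card (Quotient s)) := Fintype.equivFin _
  let fib : Fin (Fintype.card (Quotient s)) → Type := fun i => {k : Fin n // e ⟦k⟧ = i}
  let ε : ∀ i, fib i ≃ Fin (Fintype.card (fib i)) := fun i => Fintype.equivFin _
  let D : SkewForm K G :=
    { l := l
      b := b
      t := t
      q := q
      tgt_eq := fun i => (htq i).1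
      q_ne := fun i => (htq i).2.1
      t_ne := fun i => (htq i).2.2
      m := Fintype.card (Quotient s)
      size := fun i => Fintype.card (fib i)
      size_pos := fun i => by
        obtain ⟨k, hk⟩ := Quotient.exists_rep (e.symm i)
        exact Fintype.card_pos_iff.2 ⟨⟨k, by rw [hk, e.apply_symm_apply]⟩⟩
      c := fun i j => c ((ε i).symm j).1
      x := fun i j => x ((ε i).symm j).1
      y := fun i j => y ((ε i).symm j).1
      x_tgt := fun i j => hxy _
      y_closed := fun i j => hy _
      y_rotates := fun i j i' j' => by
        rw [Path.rotates_iff (hy _) (hy _)]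
        have h : (y ((ε i).symm j).1).edges ~r (y ((ε i').symm j').1).edges ↔
            (⟦((ε i).symm j).1⟧ : Quotient s) = ⟦((ε i').symm j').1⟧ :=
          (Quotient.eq (r := s)).symm
        rw [h, ← e.apply_eq_iff_eq, ((ε i).symm j).2, ((ε i').symm j').2] }
  refine ⟨D, ?_⟩
  rw [value_eq]
  congr 1
  rw [← Fintype.sum_fiberwise (fun k : Fin n => e ⟦k⟧)
    fun k => c k • skewLoop K (x k) (y k)]
  refine Finset.sum_congr rfl fun i _ => ?_
  exact (ε i).symm.sum_comp fun k : fib i => c k.1 • skewLoop K (x k.1) (y k.1)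

theorem exists_skewForm_of_mem {z : LeavittPathAlgebra K G} (hz : z ∈ skewSpan K G) :
    ∃ D : SkewForm K G, z = D.value := by
  obtain ⟨z₁, h₁, z₂, h₂, rfl⟩ := Submodule.mem_sup.1 hz
  obtain ⟨l, b, f, rfl⟩ := Submodule.mem_span_set'.1 h₁
  obtain ⟨n, c, g, rfl⟩ := Submodule.mem_span_set'.1 h₂
  choose t q htq hf using fun i => (f i).2
  choose x y hxy hy hg using fun i => (g i).2
  obtain ⟨D, hD⟩ := exists_skewForm b t q htq c x y hxy hy
  refine ⟨D, ?_⟩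
  simp only [hD, hf, hg]

theorem exists_sum_of_mem_diagSpan {d : LeavittPathAlgebra K G} (hd : d ∈ diagSpan K G) :
    ∃ (k : ℕ) (a : Fin k → K) (p : Fin k → G.Path),
      d = ∑ i, a i • (ofPath K (p i) * star (ofPath K (p i))) := by
  obtain ⟨k, a, f, rfl⟩ := Submodule.mem_span_set'.1 hd
  choose p hp using fun i => (f i).2
  exact ⟨k, a, p, by simp only [← hp]⟩

/-! ### Balanced skew forms are sums of commutators -/

theorem mkQ_mul_comm (a b : LeavittPathAlgebra K G) :
    (commutators K G).mkQ (a * b) = (commutators K G).mkQ (b * a) := by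
  rw [← sub_eq_zero, ← map_sub, Submodule.mkQ_apply, Submodule.Quotient.mk_eq_zero]
  exact Submodule.subset_span ⟨a, b, rfl⟩

/-- Modulo commutators t q* is q* t, which is 0 because neither path is an initial segment of the
other. -/
theorem mkQ_skewPair {t q : G.Path} (h : IsTransverse t q) :
    (commutators K G).mkQ (skewPair K t q) = 0 := by
  rw [skewPair, map_sub, mkQ_mul_comm, mkQ_mul_comm (ofPath K q), h.star_mul_eq_zero,
    h.symm.star_mul_eq_zero, sub_self]

/-- Moving x to the right end produces x* x = r(x), which y and y* absorb. -/
theorem mkQ_skewLoop {x y : G.Path} (h : x.tgt = y.src) (hy : y.IsClosed) :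
    (commutators K G).mkQ (skewLoop K x y) =
      (commutators K G).mkQ (star (ofPath K y)) - (commutators K G).mkQ (ofPath K y) := by
  rw [skewLoop, map_sub, mul_assoc, mul_assoc, mkQ_mul_comm, mkQ_mul_comm (ofPath K x), mul_assoc,
    mul_assoc, star_ofPath_mul_ofPath, h, star_ofPath_mul_vtx, hy, ofPath_mul_vtx]

theorem mkQ_ofPath_of_rotates {y z : G.Path} (h : y.Rotates z) :
    (commutators K G).mkQ (ofPath K y) = (commutators K G).mkQ (ofPath K z) := by
  obtain ⟨a, b, hab, hba⟩ := h
  rw [ofPath_isConcat hab, ofPath_isConcat hba, mkQ_mul_comm]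

theorem mkQ_star_ofPath_of_rotates {y z : G.Path} (h : y.Rotates z) :
    (commutators K G).mkQ (star (ofPath K y)) = (commutators K G).mkQ (star (ofPath K z)) := by
  obtain ⟨a, b, hab, hba⟩ := h
  rw [ofPath_isConcat hab, ofPath_isConcat hba, star_mul, star_mul, mkQ_mul_comm]

/-- Within row i all yᵢⱼ are congruent to the first one, y, so the row contributes (∑ⱼ cᵢⱼ)(y* - y).
-/
theorem value_mem_commutators {D : SkewForm K G} (hD : D.IsBalanced) :
    D.value ∈ commutators K G := by
  rw [← Submodule.Quotient.mk_eq_zero, ← Submodule.mkQ_apply, value_eq, map_add, map_sum, map_sum,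
    Finset.sum_eq_zero, Finset.sum_eq_zero, add_zero]
  · intro i _
    have h : ∀ j ∈ Finset.univ, (commutators K G).mkQ (D.c i j • skewLoop K (D.x i j) (D.y i j)) =
        D.c i j • ((commutators K G).mkQ (star (ofPath K (D.y i ⟨0, D.size_pos i⟩))) -
          (commutators K G).mkQ (ofPath K (D.y i ⟨0, D.size_pos i⟩))) := by
      intro j _
      have hr := (D.y_rotates i j i ⟨0, D.size_pos i⟩).2 rfl
      rw [map_smul, mkQ_skewLoop (D.x_tgt i j) (D.y_closed i j).1, mkQ_ofPath_of_rotates hr,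
        mkQ_star_ofPath_of_rotates hr]
    rw [map_sum, Finset.sum_congr rfl h, ← Finset.sum_smul, hD i, zero_smul]
  · intro i _
    rw [map_smul, mkQ_skewPair ⟨D.tgt_eq i, D.q_ne i, D.t_ne i⟩, smul_zero]

/-- The map Λ sending each basis vector to the class of its vertex kills every B_v, as e e* is
congruent to e* e = r(e). The sum in question is congruent to ∑ aᵢ r(pᵢ), a value of Λ. -/
theorem diag_mem_commutators {k : ℕ} {a : Fin k → K} {p : Fin k → G.Path}
    (h : (∑ i, Finsupp.single (p i).tgt (a i)) ∈ G.spanB K) :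
    (∑ i, a i • (ofPath K (p i) * star (ofPath K (p i)))) ∈ commutators K G := by
  let Λ : (V →₀ K) →ₗ[K] LeavittPathAlgebra K G ⧸ commutators K G :=
    Finsupp.linearCombination K fun v => (commutators K G).mkQ (vtx K G v)
  have hΛ : G.spanB K ≤ LinearMap.ker Λ := by
    refine Submodule.span_le.2 ?_
    rintro _ ⟨v, rfl⟩
    change Λ ((G.B v).mapRange (Int.cast : ℤ → K) Int.cast_zero) = 0
    by_cases hv : G.IsRegular v
    · have hs : (commutators K G).mkQ (vtx K G v) =
          ∑ e ∈ hv.1.toFinset, (commutators K G).mkQ (vtx K G (G.range e)) := by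
        rw [vtx_eq_sum hv, map_sum]
        refine Finset.sum_congr rfl fun e _ => ?_
        rw [mkQ_mul_comm, ghost_mul_edge]
      rw [mapRange_B K hv, map_sub, map_sum]
      simp only [Λ, Finsupp.linearCombination_single, one_smul]
      rw [hs, sub_self]
    · rw [mapRange_B_of_not K hv, map_zero]
  have h := hΛ h
  rw [LinearMap.mem_ker, map_sum] at h
  rw [← Submodule.Quotient.mk_eq_zero, ← Submodule.mkQ_apply, map_sum, ← h]
  refine Finset.sum_congr rfl fun i _ => ?_
  rw [map_smul, mkQ_mul_comm, star_ofPath_mul_ofPath, Finsupp.linearCombination_single]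

/-! ### Values of traces -/

section TraceValues

variable {M : Type*} [AddCommGroup M] [Module K M] {φ : V → List A → M}
  {T : LeavittPathAlgebra K G →ₗ[K] M}
  (hT : ∀ w p q, G.IsWalkTo p w → G.IsWalkTo q w → T (mono K G w p q) = traceFun G φ p q w)

include hT

theorem trace_ofPath_mul_star {p q : G.Path} (h : p.tgt = q.tgt) :
    T (ofPath K p * star (ofPath K q)) = traceFun G φ p.edges q.edges q.tgt := by
  rw [ofPath_mul_star_ofPath h, hT _ _ _ (h ▸ p.isWalkTo) q.isWalkTo]

theorem trace_diag (p : G.Path) : T (ofPath K p * star (ofPath K p)) = φ p.tgt [] := by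
  rw [trace_ofPath_mul_star hT rfl]
  have := traceFun_append (G := G) (φ := φ) (w := p.tgt) (q := p.edges) (u := [])
    (by rw [List.append_nil])
  rwa [List.append_nil] at this

theorem trace_eq_zero_of_isTransverse {t q : G.Path} (h : IsTransverse t q) :
    T (ofPath K t * star (ofPath K q)) = 0 := by
  rw [trace_ofPath_mul_star hT h.1]
  refine traceFun_of_not ?_
  rw [q.startOf_edges, ← h.1, t.startOf_edges, eq_comm (a := t.src)]
  exact h.symm.not_prefix

theorem trace_skewPair {t q : G.Path} (h : IsTransverse t q) : T (skewPair K t q) = 0 := by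
  rw [skewPair, map_sub, trace_eq_zero_of_isTransverse hT h,
    trace_eq_zero_of_isTransverse hT h.symm, sub_zero]

/-- The trace is one-sided: it vanishes on x (x y)*, where the ghost path is the longer one, and so
only x y x* contributes. -/
theorem trace_skewLoop {x y : G.Path} (h : x.tgt = y.src) (hy : y.IsNontrivialClosed) :
    T (skewLoop K x y) = - φ y.tgt y.edges := by
  have hxy : x.tgt = y.tgt := h.trans hy.1
  let z : G.Path := ⟨x.src, y.tgt, x.edges ++ y.edges, isWalk_append.2 ⟨x.tgt, x.isWalk, by
    rw [h]
    exact y.isWalk⟩⟩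
  have hz : z.IsConcat x y := ⟨rfl, h, rfl, rfl⟩
  rw [skewLoop, mul_assoc, ← star_mul, ← ofPath_isConcat hz, map_sub,
    trace_ofPath_mul_star hT (p := x) (q := z) hxy,
    trace_ofPath_mul_star hT (p := z) (q := x) hxy.symm, traceFun_of_not, zero_sub, hxy]
  · congr 1
    refine traceFun_append ?_
    rw [← hxy, x.startOf_edges, hxy]
    exact z.startOf_edges
  · intro h'
    have hl := h'.1.length_le
    have hpos := List.length_pos_iff.2 hy.2
    simp only [z, List.length_append] at hl
    omega

theorem trace_value (D : SkewForm K G) :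
    T D.value = - ∑ i, ∑ j, D.c i j • φ (D.y i j).tgt (D.y i j).edges := by
  rw [value_eq, map_add, map_sum, map_sum, Finset.sum_eq_zero, zero_add, ← Finset.sum_neg_distrib]
  · refine Finset.sum_congr rfl fun i _ => ?_
    rw [map_sum, ← Finset.sum_neg_distrib]
    refine Finset.sum_congr rfl fun j _ => ?_
    rw [map_smul, trace_skewLoop hT (D.x_tgt i j) (D.y_closed i j), smul_neg]
  · intro i _
    rw [map_smul, trace_skewPair hT ⟨D.tgt_eq i, D.q_ne i, D.t_ne i⟩, smul_zero]

end TraceValues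

/-! ### Traces detect both conditions -/

/-- The trace given by the indicator of the rotation class of row i vanishes on the diagonal part
and on the other rows, and takes the value -∑ⱼ cᵢⱼ on row i. -/
theorem isBalanced_of_mem_commutators {k : ℕ} {a : Fin k → K} {p : Fin k → G.Path}
    {D : SkewForm K G}
    (h : (∑ i, a i • (ofPath K (p i) * star (ofPath K (p i)))) + D.value ∈ commutators K G) :
    D.IsBalanced := by
  classical
  intro i
  let z : G.Path := D.y i ⟨0, D.size_pos i⟩
  have hz : z.IsNontrivialClosed := D.y_closed i _
  obtain ⟨T, hT₁, hT⟩ := exists_trace (K := K) (G := G)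
    (φ := fun _ u => if u ~r z.edges then (1 : K) else 0)
    (fun w hw => by
      have h : ¬ ([] ~r z.edges) := fun h => hz.2 (List.isRotated_nil_iff'.1 h).symm
      simp [h])
    (fun w f u _ => by
      have h : (f :: u) ~r z.edges ↔ (u ++ [f]) ~r z.edges :=
        ⟨fun h => (List.isRotated_concat f u).trans h,
          fun h => (List.isRotated_concat f u).symm.trans h⟩
      simp only [h])
  have h := hT₁ _ h
  rw [map_add, map_sum, trace_value hT, Finset.sum_eq_zero, zero_add, neg_eq_zero,
    Finset.sum_eq_single i] at h
  · rw [← h]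
    refine Finset.sum_congr rfl fun j _ => ?_
    have hr := (Path.rotates_iff (D.y_closed i j) hz).1 ((D.y_rotates i j i _).2 rfl)
    simp [hr]
  · intro i' _ hi'
    refine Finset.sum_eq_zero fun j _ => ?_
    have hr : ¬ ((D.y i' j).edges ~r z.edges) := fun hr =>
      hi' ((D.y_rotates i' j i _).1 ((Path.rotates_iff (D.y_closed i' j) hz).2 hr))
    simp [hr]
  · simp
  · intro i _
    have h : ¬ ([] ~r z.edges) := fun h => hz.2 (List.isRotated_nil_iff'.1 h).symm
    rw [map_smul, trace_diag hT, if_neg h, smul_zero]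

/-- The trace takes values in K^(E⁰) modulo the span of the B_v and is supported on vertices.
Additivity at a regular v says precisely that B_v is 0 in the quotient, and skew forms have trace 0
since each yᵢⱼ has positive length. -/
theorem mem_spanB_of_mem_commutators {k : ℕ} {a : Fin k → K} {p : Fin k → G.Path}
    {D : SkewForm K G}
    (h : (∑ i, a i • (ofPath K (p i) * star (ofPath K (p i)))) + D.value ∈ commutators K G) :
    (∑ i, Finsupp.single (p i).tgt (a i)) ∈ G.spanB K := by
  classical
  obtain ⟨T, hT₁, hT⟩ := exists_trace (K := K) (G := G)
    (φ := fun w u => if u = [] then (G.spanB K).mkQ (Finsupp.single w 1) else 0)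
    (fun w hw => by
      simp only [if_true]
      rw [eq_comm, ← map_sum, ← sub_eq_zero, ← map_sub, ← mapRange_B K hw, Submodule.mkQ_apply,
        Submodule.Quotient.mk_eq_zero]
      exact Submodule.subset_span ⟨w, rfl⟩)
    (fun w f u _ => by simp)
  have h := hT₁ _ h
  rw [map_add, map_sum, trace_value hT] at h
  have h₀ : (∑ i, ∑ j, D.c i j • if (D.y i j).edges = [] then
      (G.spanB K).mkQ (Finsupp.single (D.y i j).tgt (1 : K)) else 0) = 0 := by
    refine Finset.sum_eq_zero fun i _ => Finset.sum_eq_zero fun j _ => ?_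
    rw [if_neg (D.y_closed i j).2, smul_zero]
  rw [h₀, neg_zero, add_zero] at h
  rw [← Submodule.Quotient.mk_eq_zero, ← Submodule.mkQ_apply, map_sum, ← h]
  refine Finset.sum_congr rfl fun i _ => ?_
  rw [map_smul, trace_diag hT, if_pos rfl, ← map_smul, Finsupp.smul_single, smul_eq_mul, mul_one]

theorem star_diag_add_value (h2 : (2 : K) = 0) {k : ℕ} (a : Fin k → K) (p : Fin k → G.Path)
    (D : SkewForm K G) :
    star ((∑ i, a i • (ofPath K (p i) * star (ofPath K (p i)))) + D.value) =
      -((∑ i, a i • (ofPath K (p i) * star (ofPath K (p i)))) + D.value) := by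
  rw [star_add, star_value, neg_add]
  congr 1
  rw [neg_eq_self_of_two_eq_zero h2, ← starₗ_apply, map_sum]
  refine Finset.sum_congr rfl fun i _ => ?_
  rw [map_smul, starₗ_apply, star_mul, star_star]

end LeavittPathAlgebra

/-! ### The theorem -/

open LeavittPathAlgebra in
theorem theorem3p6 {K V A : Type*} [Field K] (G : DirectedGraph V A)
    (x : LeavittPathAlgebra K G) :
    (ringChar K ≠ 2 →
      (x ∈ skewElements K G ↔ ∃ D : SkewForm K G, x = D.value) ∧
      (x ∈ skewElements K G ∧ x ∈ commutators K G ↔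
        ∃ D : SkewForm K G, D.IsBalanced ∧ x = D.value)) ∧
    (ringChar K = 2 →
      (x ∈ skewElements K G ↔
        ∃ (k : ℕ) (a : Fin k → K) (p : Fin k → G.Path) (D : SkewForm K G),
          x = (∑ i, a i • (ofPath K (p i) * star (ofPath K (p i)))) + D.value) ∧
      (x ∈ skewElements K G ∧ x ∈ commutators K G ↔
        ∃ (k : ℕ) (a : Fin k → K) (p : Fin k → G.Path) (D : SkewForm K G),
          (∑ i, Finsupp.single (p i).tgt (a i)) ∈ G.spanB K ∧ D.IsBalanced ∧
          x = (∑ i, a i • (ofPath K (p i) * star (ofPath K (p i)))) + D.value)) := by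
  refine ⟨fun hchar => ?_, fun hchar => ?_⟩
  · have h2 : (2 : K) ≠ 0 := Ring.two_ne_zero hchar
    have main : x ∈ skewElements K G ↔ ∃ D : SkewForm K G, x = D.value := by
      refine ⟨fun hx => exists_skewForm_of_mem (mem_skewSpan_of_star_eq_neg h2 hx), ?_⟩
      rintro ⟨D, rfl⟩
      exact star_value D
    refine ⟨main, ?_, ?_⟩
    · rintro ⟨hx, hc⟩
      obtain ⟨D, rfl⟩ := main.1 hx
      -- The trace argument holds in every characteristic; here the diagonal part is empty.
      refine ⟨D, isBalanced_of_mem_commutators (k := 0) (a := Fin.elim0) (p := Fin.elim0) ?_, rfl⟩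
      simpa using hc
    · rintro ⟨D, hD, rfl⟩
      exact ⟨star_value D, value_mem_commutators hD⟩
  · have h2 : (2 : K) = 0 := by
      have := ringChar.Nat.cast_ringChar (R := K)
      rw [hchar] at this
      exact_mod_cast this
    have main : x ∈ skewElements K G ↔
        ∃ (k : ℕ) (a : Fin k → K) (p : Fin k → G.Path) (D : SkewForm K G),
          x = (∑ i, a i • (ofPath K (p i) * star (ofPath K (p i)))) + D.value := by
      constructor
      · intro hx
        obtain ⟨d, hd, z, hz, rfl⟩ := mem_diagSpan_sup_skewSpan h2 hx
        obtain ⟨k, a, p, rfl⟩ := exists_sum_of_mem_diagSpan hd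
        obtain ⟨D, rfl⟩ := exists_skewForm_of_mem hz
        exact ⟨k, a, p, D, rfl⟩
      · rintro ⟨k, a, p, D, rfl⟩
        exact star_diag_add_value h2 a p D
    refine ⟨main, ?_, ?_⟩
    · rintro ⟨hx, hc⟩
      obtain ⟨k, a, p, D, rfl⟩ := main.1 hx
      exact ⟨k, a, p, D, mem_spanB_of_mem_commutators hc, isBalanced_of_mem_commutators hc, rfl⟩
    · rintro ⟨k, a, p, D, hB, hD, rfl⟩
      exact ⟨star_diag_add_value h2 a p D,
        add_mem (diag_mem_commutators hB) (value_mem_commutators hD)⟩
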